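/- Let $n\ge 1$, let $p_1=2<p_2=3<\dots<p_n$ be the first $n$ primes, and for real $x\ge 1$ let $N(x)=N_{2,3,5,\dots,p_n}(x)$ be the number of $(q_1,\dots,q_n)\in\mathbb{N}_0^n$ with $p_1^{q_1}\cdots p_n^{q_n}\le x$. Let $\chi(x)=1$ if $x=p_1^{q_1}\cdots p_n^{q_n}$ for some $q_1,\dots,q_n\in\mathbb{N}_0$ and $\chi(x)=0$ otherwise, and let $B_1^*(\{y\})=\{y\}-\tfrac12$ for $y\in\mathbb{R}\setminus\mathbb{Z}$ and $B_1^*(\{y\})=0$ for $y\in\mathbb{Z}$. Then for every real $x\ge 1$ $$N(x)=\operatorname{Res}_{s=0}\left(\frac{x^s}{s\prod_{k=1}^n\left(1-p_k^{-s}\right)}\right)-\frac{1}{2^{n-1}}\sum_{k=1}^n B_1^*\left(\left\{\frac{\log x}{\log p_k}\right\}\right)+\frac{1}{2^{n-1}\pi}\,L(x)+\frac12\chi(x),$$ where $$L(x)=\sum_{m=1}^n\sum_{r=1}^{n-1}\ \sum_{\substack{i_1<\dots<i_r\\ \{i_1,\dots,i_r\}\subset\{p_1,\dots,p_n\}\setminus\{p_m\}}}\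 \sum_{k=1}^\infty\frac{\sin\left(2\pi k\frac{\log x}{\log p_m}-\frac{\pi r}{2}\right)}{k}\prod_{l=1}^r\cot\left(\frac{\pi k\log i_l}{\log p_m}\right).$$ Here the series are to be interpreted together, as $$L(x)=\lim_{R\to\infty}\ \sum_{m=1}^n\sum_{r=1}^{n-1}\ \sum_{\substack{i_1<\dots<i_r\\ \{i_1,\dots,i_r\}\subset\{p_1,\dots,p_n\}\setminus\{p_m\}}}\ \sum_{k=1}^{\lfloor R\log p_m\rfloor}\frac{\sin\left(2\pi k\frac{\log x}{\log p_m}-\frac{\pi r}{2}\right)}{k}\prod_{l=1}^r\cot\left(\frac{\pi k\log i_l}{\log p_m}\right),$$ where $R\to\infty$ in an appropriate manner, namely through any sequence $R_j\to\infty$ for which there is a $\delta>0$ such that $|R_j\log p_k-\nu|\ge\delta$ for all $j$, all $1\le k\le n$ and all $\nu\in\mathbb{Z}$. Such sequences exist, and for each $x\ge1$ the limit exists along each of them and does not depend on the choice. -/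

import Mathlib

open Filter Topology

noncomputable section

/-- `p_1, …, p_n`: the first `n` primes, indexed by `Fin n` (so `firstPrimes n 0 = 2`). -/
def firstPrimes (n : ℕ) (k : Fin n) : ℕ := Nat.nth Nat.Prime k

/-- `a_1^{q_1} ⋯ a_n^{q_n}`. -/
def powerProduct {n : ℕ} (a : Fin n → ℕ) (q : Fin n → ℕ) : ℕ := ∏ k, a k ^ q k

/-- `N_{a_1,…,a_n}(x)`: the number of exponent vectors `q ∈ ℕ^n` with
`a_1^{q_1} ⋯ a_n^{q_n} ≤ x`. -/
def countProducts {n : ℕ} (a : Fin n → ℕ) (x : ℝ) : ℕ :=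
  Set.ncard {q : Fin n → ℕ | (powerProduct a q : ℝ) ≤ x}

/-- `S_{a_1,…,a_n}`, as a set of real numbers. -/
def productSet {n : ℕ} (a : Fin n → ℕ) : Set ℝ :=
  Set.range fun q : Fin n → ℕ => (powerProduct a q : ℝ)

/-- The characteristic function of `S_{a_1,…,a_n}`. -/
def productChi {n : ℕ} (a : Fin n → ℕ) (x : ℝ) : ℝ :=
  (productSet a).indicator (fun _ => 1) x

open Classical in
/-- `B₁^*({y})`: equal to `{y} - 1/2` if `y ∉ ℤ` and to `0` if `y ∈ ℤ`. -/
def bernoulliStar (y : ℝ) : ℝ :=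
  if y ∈ Set.range ((↑) : ℤ → ℝ) then 0 else Int.fract y - 1 / 2

/-- The residue at `z₀` of a function that is holomorphic in a punctured neighbourhood of `z₀`:
`(2πi)⁻¹ ∮_{|z - z₀| = r} f(z) dz` for all small `r > 0` (it does not depend on `r` then). -/
def residue (f : ℂ → ℂ) (z₀ : ℂ) : ℂ :=
  limUnder (𝓝[>] (0 : ℝ)) fun r : ℝ => (2 * Real.pi * Complex.I)⁻¹ * ∮ z in C(z₀, r), f z

/-- `x^s / (s ∏_k (1 - 1 / a_k^s))`. -/
def perronIntegrand {n : ℕ} (a : Fin n → ℕ) (x : ℝ) (s : ℂ) : ℂ :=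
  (x : ℂ) ^ s / (s * ∏ k, (1 - 1 / (a k : ℂ) ^ s))

/-- The `k`-th term of the series that belongs to `m` and to the index set
`I = {i_1, …, i_r} ∌ m`. -/
def cotangentTerm {n : ℕ} (a : Fin n → ℕ) (x : ℝ) (m : Fin n) (I : Finset (Fin n)) (k : ℕ) : ℝ :=
  Real.sin (2 * Real.pi * k * (Real.log x / Real.log (a m)) - Real.pi * I.card / 2) / k *
    ∏ l ∈ I, Real.cot (Real.pi * k * Real.log (a l) / Real.log (a m))

/-- The sum over `m`, over `r = 1, …, n - 1` and over all `r`-element index sets not containing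
`m` of the series truncated at `⌊R log a_m⌋`, with one common parameter `R`. -/
def cotangentSum {n : ℕ} (a : Fin n → ℕ) (x R : ℝ) : ℝ :=
  ∑ m : Fin n, ∑ r ∈ Finset.Icc 1 (n - 1),
    ∑ I ∈ Finset.powersetCard r (Finset.univ.erase m),
      ∑ k ∈ Finset.Icc 1 ⌊R * Real.log (a m)⌋₊, cotangentTerm a x m I k

/-- `R → ∞` in an appropriate manner: all the numbers `R_j log a_k` keep a distance `≥ δ > 0` from
the integers, that is, the lines `Im s = ±2πR_j` avoid the poles `2πiν / log a_k` by a margin. -/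
def AppropriateCutoffs {n : ℕ} (a : Fin n → ℕ) (R : ℕ → ℝ) : Prop :=
  Tendsto R atTop atTop ∧
    ∃ δ : ℝ, 0 < δ ∧ ∀ (j : ℕ) (k : Fin n) (ν : ℤ), δ ≤ |R j * Real.log (a k) - ν|

end

/-! The proof is Perron's formula with the contour moved across the imaginary axis. For `Re s > 0`
the finite Euler product expands the integrand as the sum of `(x / P(q))^s / s` over all exponent
vectors `q`, where `P(q)` is the corresponding product. Integrated over `Re s = 1`, a term tends to
`2π`, `π` or `0` according as `P(q)` is less than, equal to or greater than `x`. Since the `x /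
P(q)` are summable, the limit may be taken termwise and gives `2πN(x) - πχ(x)`
(`tendsto_integral_perronIntegrand`).

The other three sides of the rectangle with corners `±1 ± 2πiR` vanish in the limit. On the left
side, `s ↦ -s` turns the integrand, up to sign, into the same integrand with `x` replaced by `1 / (x
∏ p_k) < 1`, for which nothing is counted (`perronIntegrand_neg`). On the horizontal sides the
cutoff condition keeps every `|1 - p_k^{-s}|` above `2δ`, and the factor `1 / s` supplies `O(1 / R)`
(`norm_perronIntegrand_le`).

By the residue theorem, what remains is the residue at `0` plus those at `2πiν / log p_m` with `ν ≠
0`. These poles are simple, because by unique factorization different primes share only the pole at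
`0`. With `1 / (1 - e^{-2iθ}) = (1 - i cot θ) / 2` each residue expands over the subsets of the
other primes, and `ν` and `-ν` combine to sines (`residueTerm_add_neg`). The empty subset yields the
Fourier series of the sawtooth (`tendsto_sum_sin_div`), the nonempty ones yield the cotangent sums.
The whole sum converges along every admissible sequence, to a value fixed by the other quantities;
subtracting the convergent sawtooth part gives existence and independence of the limit `L`.
Admissible sequences come from simultaneous Diophantine approximation (`exists_appropriateCutoffs`).
-/

/-! ### Integrals over the boundary of a rectangle -/

/-- The integral over the boundary of the rectangle with opposite corners `z` and `w`. -/
noncomputable def rectIntegral (f : ℂ → ℂ) (z w : ℂ) : ℂ :=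
  (∫ x : ℝ in z.re..w.re, f (x + z.im * Complex.I)) -
    (∫ x : ℝ in z.re..w.re, f (x + w.im * Complex.I)) +
    Complex.I * (∫ y : ℝ in z.im..w.im, f (w.re + y * Complex.I)) -
    Complex.I * (∫ y : ℝ in z.im..w.im, f (z.re + y * Complex.I))

/-- The open rectangle with lower left corner `z` and upper right corner `w`. -/
def openRect (z w : ℂ) : Set ℂ := Set.Ioo z.re w.re ×ℂ Set.Ioo z.im w.im

/-- The closed rectangle with lower left corner `z` and upper right corner `w`. -/
def closedRect (z w : ℂ) : Set ℂ := Set.Icc z.re w.re ×ℂ Set.Icc z.im w.im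

/-- The boundary of the rectangle with lower left corner `z` and upper right corner `w`. -/
def rectBoundary (z w : ℂ) : Set ℂ := closedRect z w \ openRect z w

section rect

variable {f g : ℂ → ℂ} {z w : ℂ}

lemma bottom_mem_rectBoundary (him : z.im ≤ w.im) {x : ℝ} (hx : x ∈ Set.Icc z.re w.re) :
    (x + z.im * Complex.I : ℂ) ∈ rectBoundary z w := by
  constructor
  · simpa [closedRect, Complex.mem_reProdIm, him] using hx
  · simp [openRect, Complex.mem_reProdIm]

lemma top_mem_rectBoundary (him : z.im ≤ w.im) {x : ℝ} (hx : x ∈ Set.Icc z.re w.re) :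
    (x + w.im * Complex.I : ℂ) ∈ rectBoundary z w := by
  constructor
  · simpa [closedRect, Complex.mem_reProdIm, him] using hx
  · simp [openRect, Complex.mem_reProdIm]

lemma right_mem_rectBoundary (hre : z.re ≤ w.re) {y : ℝ} (hy : y ∈ Set.Icc z.im w.im) :
    (w.re + y * Complex.I : ℂ) ∈ rectBoundary z w := by
  constructor
  · simpa [closedRect, Complex.mem_reProdIm, hre] using hy
  · simp [openRect, Complex.mem_reProdIm]

lemma left_mem_rectBoundary (hre : z.re ≤ w.re) {y : ℝ} (hy : y ∈ Set.Icc z.im w.im) :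
    (z.re + y * Complex.I : ℂ) ∈ rectBoundary z w := by
  constructor
  · simpa [closedRect, Complex.mem_reProdIm, hre] using hy
  · simp [openRect, Complex.mem_reProdIm]

lemma rectIntegral_congr (hre : z.re ≤ w.re) (him : z.im ≤ w.im)
    (h : Set.EqOn f g (rectBoundary z w)) : rectIntegral f z w = rectIntegral g z w := by
  unfold rectIntegral
  congr 1
  · congr 1
    · congr 1
      · refine intervalIntegral.integral_congr fun x hx => h ?_
        rw [Set.uIcc_of_le hre] at hx
        exact bottom_mem_rectBoundary him hx
      · refine intervalIntegral.integral_congr fun x hx => h ?_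
        rw [Set.uIcc_of_le hre] at hx
        exact top_mem_rectBoundary him hx
    · congr 1
      refine intervalIntegral.integral_congr fun x hx => h ?_
      rw [Set.uIcc_of_le him] at hx
      exact right_mem_rectBoundary hre hx
  · congr 1
    refine intervalIntegral.integral_congr fun x hx => h ?_
    rw [Set.uIcc_of_le him] at hx
    exact left_mem_rectBoundary hre hx

lemma intervalIntegrable_bottom (hre : z.re ≤ w.re) (him : z.im ≤ w.im)
    (hf : ContinuousOn f (rectBoundary z w)) :
    IntervalIntegrable (fun x : ℝ => f (x + z.im * Complex.I)) MeasureTheory.volume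
      z.re w.re := by
  refine ContinuousOn.intervalIntegrable (hf.comp (by fun_prop) fun x hx => ?_)
  rw [Set.uIcc_of_le hre] at hx
  exact bottom_mem_rectBoundary him hx

lemma intervalIntegrable_top (hre : z.re ≤ w.re) (him : z.im ≤ w.im)
    (hf : ContinuousOn f (rectBoundary z w)) :
    IntervalIntegrable (fun x : ℝ => f (x + w.im * Complex.I)) MeasureTheory.volume
      z.re w.re := by
  refine ContinuousOn.intervalIntegrable (hf.comp (by fun_prop) fun x hx => ?_)
  rw [Set.uIcc_of_le hre] at hx
  exact top_mem_rectBoundary him hx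

lemma intervalIntegrable_right (hre : z.re ≤ w.re) (him : z.im ≤ w.im)
    (hf : ContinuousOn f (rectBoundary z w)) :
    IntervalIntegrable (fun y : ℝ => f (w.re + y * Complex.I)) MeasureTheory.volume
      z.im w.im := by
  refine ContinuousOn.intervalIntegrable (hf.comp (by fun_prop) fun x hx => ?_)
  rw [Set.uIcc_of_le him] at hx
  exact right_mem_rectBoundary hre hx

lemma intervalIntegrable_left (hre : z.re ≤ w.re) (him : z.im ≤ w.im)
    (hf : ContinuousOn f (rectBoundary z w)) :
    IntervalIntegrable (fun y : ℝ => f (z.re + y * Complex.I)) MeasureTheory.volume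
      z.im w.im := by
  refine ContinuousOn.intervalIntegrable (hf.comp (by fun_prop) fun x hx => ?_)
  rw [Set.uIcc_of_le him] at hx
  exact left_mem_rectBoundary hre hx

lemma rectIntegral_add (hre : z.re ≤ w.re) (him : z.im ≤ w.im)
    (hf : ContinuousOn f (rectBoundary z w)) (hg : ContinuousOn g (rectBoundary z w)) :
    rectIntegral (fun s => f s + g s) z w = rectIntegral f z w + rectIntegral g z w := by
  unfold rectIntegral
  rw [intervalIntegral.integral_add (intervalIntegrable_bottom hre him hf)
      (intervalIntegrable_bottom hre him hg),
    intervalIntegral.integral_add (intervalIntegrable_top hre him hf)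
      (intervalIntegrable_top hre him hg),
    intervalIntegral.integral_add (intervalIntegrable_right hre him hf)
      (intervalIntegrable_right hre him hg),
    intervalIntegral.integral_add (intervalIntegrable_left hre him hf)
      (intervalIntegrable_left hre him hg)]
  ring

lemma rectIntegral_const_mul (c : ℂ) :
    rectIntegral (fun s => c * f s) z w = c * rectIntegral f z w := by
  unfold rectIntegral
  simp only [intervalIntegral.integral_const_mul]
  ring

lemma rectIntegral_sum {ι : Type*} (S : Finset ι) (F : ι → ℂ → ℂ) (hre : z.re ≤ w.re)
    (him : z.im ≤ w.im) (hF : ∀ i ∈ S, ContinuousOn (F i) (rectBoundary z w)) :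
    rectIntegral (fun s => ∑ i ∈ S, F i s) z w = ∑ i ∈ S, rectIntegral (F i) z w := by
  classical
  induction S using Finset.induction_on with
  | empty => simp [rectIntegral]
  | insert a S ha ih =>
    have hS : ∀ i ∈ S, ContinuousOn (F i) (rectBoundary z w) := fun i hi =>
      hF i (Finset.mem_insert_of_mem hi)
    simp only [Finset.sum_insert ha]
    rw [rectIntegral_add hre him (hF a (Finset.mem_insert_self a S))
      (continuousOn_finsetSum S hS), ih hS]

lemma rectIntegral_eq_zero (hre : z.re ≤ w.re) (him : z.im ≤ w.im)
    (hf : ∀ s ∈ closedRect z w, DifferentiableAt ℂ f s) : rectIntegral f z w = 0 := by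
  have := Complex.integral_boundary_rect_eq_zero_of_differentiableOn f z w (fun s hs => by
    rw [Set.uIcc_of_le hre, Set.uIcc_of_le him] at hs
    exact (hf s hs).differentiableWithinAt)
  simpa only [smul_eq_mul, rectIntegral] using this

lemma hasDerivAt_horizontal {G : ℂ → ℂ} {d : ℂ} {x y : ℝ}
    (h : HasDerivAt G d (x + y * Complex.I)) :
    HasDerivAt (fun t : ℝ => G (t + y * Complex.I)) d x := by
  have h1 : HasDerivAt (fun t : ℝ => (t : ℂ) + y * Complex.I) 1 x :=
    (Complex.ofRealCLM.hasDerivAt (x := x)).add_const _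
  simpa [Function.comp_def] using HasDerivAt.comp x h h1

lemma hasDerivAt_vertical {G : ℂ → ℂ} {d : ℂ} {x y : ℝ}
    (h : HasDerivAt G d (x + y * Complex.I)) :
    HasDerivAt (fun t : ℝ => G (x + t * Complex.I)) (Complex.I * d) y := by
  have h1 : HasDerivAt (fun t : ℝ => (x : ℂ) + t * Complex.I) Complex.I y := by
    simpa using ((Complex.ofRealCLM.hasDerivAt (x := y)).mul_const Complex.I).const_add (x : ℂ)
  simpa [Function.comp_def, mul_comm] using HasDerivAt.comp y h h1

lemma integral_horizontal {G : ℂ → ℂ} {a b y : ℝ} (hab : a ≤ b)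
    (h : ∀ x ∈ Set.Icc a b, HasDerivAt G (f (x + y * Complex.I)) (x + y * Complex.I))
    (hf : IntervalIntegrable (fun x : ℝ => f (x + y * Complex.I)) MeasureTheory.volume a b) :
    ∫ x : ℝ in a..b, f (x + y * Complex.I) = G (b + y * Complex.I) - G (a + y * Complex.I) := by
  refine intervalIntegral.integral_eq_sub_of_hasDerivAt
    (f := fun t : ℝ => G (t + y * Complex.I)) (fun x hx => ?_) hf
  rw [Set.uIcc_of_le hab] at hx
  exact hasDerivAt_horizontal (h x hx)

lemma integral_vertical {G : ℂ → ℂ} {a b x : ℝ} (hab : a ≤ b)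
    (h : ∀ y ∈ Set.Icc a b, HasDerivAt G (f (x + y * Complex.I)) (x + y * Complex.I))
    (hf : IntervalIntegrable (fun y : ℝ => f (x + y * Complex.I)) MeasureTheory.volume a b) :
    Complex.I * ∫ y : ℝ in a..b, f (x + y * Complex.I) =
      G (x + b * Complex.I) - G (x + a * Complex.I) := by
  rw [← intervalIntegral.integral_const_mul]
  refine intervalIntegral.integral_eq_sub_of_hasDerivAt
    (f := fun t : ℝ => G (x + t * Complex.I)) (fun y hy => ?_) (hf.const_mul _)
  rw [Set.uIcc_of_le hab] at hy
  exact hasDerivAt_vertical (h y hy)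

lemma rectIntegral_of_hasDerivAt (hre : z.re ≤ w.re) (him : z.im ≤ w.im) {G : ℂ → ℂ}
    (hf : ContinuousOn f (rectBoundary z w))
    (hG : ∀ s ∈ rectBoundary z w, HasDerivAt G (f s) s) : rectIntegral f z w = 0 := by
  unfold rectIntegral
  rw [integral_horizontal hre (fun x hx => hG _ (bottom_mem_rectBoundary him hx))
      (intervalIntegrable_bottom hre him hf),
    integral_horizontal hre (fun x hx => hG _ (top_mem_rectBoundary him hx))
      (intervalIntegrable_top hre him hf),
    integral_vertical him (fun x hx => hG _ (right_mem_rectBoundary hre hx))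
      (intervalIntegrable_right hre him hf),
    integral_vertical him (fun x hx => hG _ (left_mem_rectBoundary hre hx))
      (intervalIntegrable_left hre him hf)]
  ring

lemma ne_of_mem_rectBoundary {p s : ℂ} (hp : p ∈ openRect z w) (hs : s ∈ rectBoundary z w) :
    s ≠ p := by
  rintro rfl
  exact hs.2 hp

lemma continuousOn_zpow_rectBoundary {p : ℂ} (hp : p ∈ openRect z w) (m : ℤ) :
    ContinuousOn (fun s => (s - p) ^ m) (rectBoundary z w) := fun _ hs =>
  ((continuousAt_id.sub continuousAt_const).zpow₀ m
    (Or.inl (sub_ne_zero.2 (ne_of_mem_rectBoundary hp hs)))).continuousWithinAt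

/-- Away from exponent `-1` the power has a single-valued primitive off `p`, so its integral over a
closed path vanishes. -/
lemma rectIntegral_zpow {p : ℂ} (hp : p ∈ openRect z w) {m : ℤ} (hm : m ≠ -1) :
    rectIntegral (fun s => (s - p) ^ m) z w = 0 := by
  have hre : z.re ≤ w.re := (hp.1.1.trans hp.1.2).le
  have him : z.im ≤ w.im := (hp.2.1.trans hp.2.2).le
  have hm' : (m : ℂ) + 1 ≠ 0 := by
    intro h
    apply hm
    have : (m : ℂ) = ((-1 : ℤ) : ℂ) := by push_cast; linear_combination h
    exact_mod_cast this
  refine rectIntegral_of_hasDerivAt (G := fun s => (s - p) ^ (m + 1) / (m + 1)) hre him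
    (continuousOn_zpow_rectBoundary hp m) fun s hs => ?_
  have h0 : s - p ≠ 0 := sub_ne_zero.2 (ne_of_mem_rectBoundary hp hs)
  have h1 := (hasDerivAt_zpow (m + 1) (s - p) (Or.inl h0)).comp s ((hasDerivAt_id s).sub_const p)
  have h2 := h1.div_const ((m : ℂ) + 1)
  have h3 : ((m + 1 : ℤ) : ℂ) * (s - p) ^ (m + 1 - 1) * 1 / ((m : ℂ) + 1) = (s - p) ^ m := by
    rw [add_sub_cancel_right]
    push_cast
    field_simp
  rw [h3] at h2
  exact h2

/-- The jump between two branches of the logarithm, cut along rays a quarter turn apart; it is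
needed once at each corner of a rectangle. -/
lemma log_sub_log_neg_I_mul {v : ℂ} (hre : 0 < v.re) (him : 0 < v.im) :
    Complex.log v - Complex.log (-Complex.I * v) = Complex.I * (Real.pi / 2) := by
  have hv : v ≠ 0 := by rintro rfl; simp at hre
  have h0 : 0 ≤ v.arg := Complex.arg_nonneg_iff.2 him.le
  have hpi := Complex.arg_le_pi v
  have hpos := Real.pi_pos
  rw [Complex.log_mul (by simp) hv]
  · rw [Complex.log_neg_I]; ring
  · rw [Complex.arg_neg_I]
    constructor <;> linarith

/-- Each side lies in an open half plane bounded by a line through `p`, so after rotation by `I`,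
`-I`, `1` or `-1` the principal logarithm is a primitive there. The four primitives disagree at the
corners, and each corner contributes `πi / 2`. -/
lemma rectIntegral_inv {p : ℂ} (hp : p ∈ openRect z w) :
    rectIntegral (fun s => (s - p)⁻¹) z w = 2 * Real.pi * Complex.I := by
  have hre : z.re ≤ w.re := (hp.1.1.trans hp.1.2).le
  have him : z.im ≤ w.im := (hp.2.1.trans hp.2.2).le
  have hz1 : z.re < p.re := hp.1.1
  have hw1 : p.re < w.re := hp.1.2
  have hz2 : z.im < p.im := hp.2.1
  have hw2 : p.im < w.im := hp.2.2
  have hc : ContinuousOn (fun s => (s - p)⁻¹) (rectBoundary z w) := by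
    simpa using continuousOn_zpow_rectBoundary hp (-1)
  have key : ∀ u s : ℂ, u ≠ 0 → 0 < (u * (s - p)).re →
      HasDerivAt (fun s => Complex.log (u * (s - p))) (s - p)⁻¹ s := by
    intro u s hu hs
    have h1 : HasDerivAt (fun s => u * (s - p)) u s := by
      simpa using ((hasDerivAt_id s).sub_const p).const_mul u
    have h2 := h1.clog (Or.inl hs)
    convert h2 using 1
    rw [div_mul_eq_div_div, div_self hu, one_div]
  unfold rectIntegral
  rw [integral_horizontal (G := fun s => Complex.log (Complex.I * (s - p))) hre
      (fun x hx => key _ _ Complex.I_ne_zero (by simp; linarith))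
      (intervalIntegrable_bottom hre him hc),
    integral_horizontal (G := fun s => Complex.log (-Complex.I * (s - p))) hre
      (fun x hx => key _ _ (by simp) (by simp; linarith))
      (intervalIntegrable_top hre him hc),
    integral_vertical (G := fun s => Complex.log (1 * (s - p))) him
      (fun x hx => key _ _ one_ne_zero (by simp; linarith))
      (intervalIntegrable_right hre him hc),
    integral_vertical (G := fun s => Complex.log (-1 * (s - p))) him
      (fun x hx => key _ _ (by simp) (by simp; linarith))
      (intervalIntegrable_left hre him hc)]
  have e1 := log_sub_log_neg_I_mul (v := 1 * (w.re + w.im * Complex.I - p))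
    (by simp; linarith) (by simp; linarith)
  have e2 := log_sub_log_neg_I_mul (v := -Complex.I * (z.re + w.im * Complex.I - p))
    (by simp; linarith) (by simp; linarith)
  have e3 := log_sub_log_neg_I_mul (v := -1 * (z.re + z.im * Complex.I - p))
    (by simp; linarith) (by simp; linarith)
  have e4 := log_sub_log_neg_I_mul (v := Complex.I * (w.re + z.im * Complex.I - p))
    (by simp; linarith) (by simp; linarith)
  have i2 : -Complex.I * (-Complex.I * (z.re + w.im * Complex.I - p)) =
      -1 * (z.re + w.im * Complex.I - p) := by rw [← mul_assoc]; simp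
  have i3 : -Complex.I * (-1 * (z.re + z.im * Complex.I - p)) =
      Complex.I * (z.re + z.im * Complex.I - p) := by ring
  have i4 : -Complex.I * (Complex.I * (w.re + z.im * Complex.I - p)) =
      1 * (w.re + z.im * Complex.I - p) := by rw [← mul_assoc]; simp
  rw [i2] at e2
  rw [i3] at e3
  rw [i4] at e4
  rw [one_mul (w.re + w.im * Complex.I - p)] at e1
  simp only [one_mul] at e1 e4 ⊢
  linear_combination e1 + e2 + e3 + e4

end rect

/-! ### Residues -/

/-- The function `∑_{j < N} c_j (s - p)^{-j-1}`. -/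
noncomputable def principalPart (p : ℂ) (N : ℕ) (c : ℕ → ℂ) (s : ℂ) : ℂ :=
  ∑ j ∈ Finset.range N, c j * (s - p) ^ (-(j : ℤ) - 1)

/-- Repeated division with remainder: `g = g p + (s - p) * dslope g p`, and `dslope g p` is again
analytic, so each step splits off one coefficient. -/
lemma exists_laurent_of_analyticAt (p : ℂ) (N : ℕ) {g : ℂ → ℂ} (hg : AnalyticAt ℂ g p) :
    ∃ c : ℕ → ℂ, ∃ h : ℂ → ℂ, AnalyticAt ℂ h p ∧
      ∀ s ≠ p, (s - p) ^ (-(N : ℤ)) * g s = principalPart p N c s + h s := by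
  induction N generalizing g with
  | zero => exact ⟨0, g, hg, fun s _ => by simp [principalPart]⟩
  | succ N ih =>
    have hd : AnalyticAt ℂ (dslope g p) p := by
      obtain ⟨q, hq⟩ := hg
      exact hq.has_fpower_series_dslope_fslope.analyticAt
    obtain ⟨c, h, hh, hc⟩ := ih hd
    refine ⟨fun j => if j = N then g p else c j, h, hh, fun s hs => ?_⟩
    have h0 : s - p ≠ 0 := sub_ne_zero.2 hs
    have h1 : g s = g p + (s - p) * dslope g p s := by
      have := sub_smul_dslope g p s
      rw [smul_eq_mul] at this
      rw [this]; ring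
    have h2 : principalPart p (N + 1) (fun j => if j = N then g p else c j) s =
        principalPart p N c s + g p * (s - p) ^ (-(N : ℤ) - 1) := by
      unfold principalPart
      rw [Finset.sum_range_succ]
      simp only [if_true]
      congr 1
      refine Finset.sum_congr rfl fun j hj => ?_
      rw [if_neg (Finset.mem_range.1 hj).ne]
    have h3 : (s - p) ^ (-((N + 1 : ℕ) : ℤ)) = (s - p) ^ (-(N : ℤ) - 1) := by
      congr 1; push_cast; ring
    have h4 : (s - p) ^ (-(N : ℤ) - 1) * (s - p) = (s - p) ^ (-(N : ℤ)) := by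
      rw [zpow_sub_one₀ h0, inv_mul_cancel_right₀ h0]
    rw [h2, h3, h1, mul_add, ← mul_assoc, h4, hc s hs]
    ring

lemma MeromorphicAt.exists_laurent {f : ℂ → ℂ} {p : ℂ} (hf : MeromorphicAt f p) :
    ∃ N : ℕ, ∃ c : ℕ → ℂ, ∃ h : ℂ → ℂ, AnalyticAt ℂ h p ∧
      ∀ s ≠ p, f s = principalPart p (N + 1) c s + h s := by
  obtain ⟨N, hN⟩ := hf
  -- One power more than necessary, so that the principal part is never empty and `c 0` is always
  -- the residue.
  have hN' : AnalyticAt ℂ (fun z => (z - p) ^ (N + 1) * f z) p := by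
    have h1 : AnalyticAt ℂ (fun z : ℂ => z - p) p := analyticAt_id.sub analyticAt_const
    refine (h1.mul hN).congr (Eventually.of_forall fun z => ?_)
    simp only [Pi.mul_apply, smul_eq_mul, pow_succ]
    ring
  obtain ⟨c, h, hh, hc⟩ := exists_laurent_of_analyticAt p (N + 1) hN'
  refine ⟨N, c, h, hh, fun s hs => ?_⟩
  have h0 : s - p ≠ 0 := sub_ne_zero.2 hs
  rw [← hc s hs, ← mul_assoc, zpow_neg, zpow_natCast, inv_mul_cancel₀ (pow_ne_zero _ h0), one_mul]

lemma circleIntegral_principalPart (p : ℂ) (N : ℕ) (c : ℕ → ℂ) {r : ℝ} (hr : 0 < r) :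
    (∮ s in C(p, r), principalPart p (N + 1) c s) = 2 * Real.pi * Complex.I * c 0 := by
  have hint : ∀ m : ℤ, CircleIntegrable (fun s => (s - p) ^ m) p r := fun m => by
    rw [circleIntegrable_sub_zpow_iff]
    right; right
    simp [abs_of_pos hr, hr.ne]
  unfold principalPart
  have hs := circleIntegral.integral_fun_sum (s := Finset.range (N + 1))
    (f := fun (j : ℕ) s => c j * (s - p) ^ (-(j : ℤ) - 1)) (c := p) (R := r)
    fun j _ => (hint _).const_fun_smul (a := c j)
  rw [hs, Finset.sum_range_succ', Finset.sum_eq_zero, zero_add]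
  · simp only [Nat.cast_zero, neg_zero, zero_sub, zpow_neg_one]
    rw [circleIntegral.integral_const_mul, circleIntegral.integral_sub_center_inv p hr.ne']
    ring
  · intro j _
    rw [circleIntegral.integral_const_mul, circleIntegral.integral_sub_zpow_of_ne, mul_zero]
    push_cast
    omega

/-- The circle integral is constant for all small radii, as the analytic part contributes nothing;
hence the `limUnder` is a genuine limit. -/
lemma residue_eq_of_laurent {f h : ℂ → ℂ} {p : ℂ} {N : ℕ} {c : ℕ → ℂ} (hh : AnalyticAt ℂ h p)
    (hf : ∀ s ≠ p, f s = principalPart p (N + 1) c s + h s) : residue f p = c 0 := by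
  unfold residue
  refine Tendsto.limUnder_eq (tendsto_const_nhds.congr' ?_)
  obtain ⟨ε, hε, hd⟩ := Metric.eventually_nhds_iff_ball.1 hh.eventually_analyticAt
  filter_upwards [Ioo_mem_nhdsGT hε] with r hr
  have hsub : Metric.closedBall p r ⊆ Metric.ball p ε := Metric.closedBall_subset_ball hr.2
  have hdiff : ∀ s ∈ Metric.closedBall p r, DifferentiableAt ℂ h s := fun s hs =>
    (hd s (hsub hs)).differentiableAt
  have h0 : (∮ s in C(p, r), h s) = 0 :=
    Complex.circleIntegral_eq_zero_of_differentiable_on_off_countable hr.1.le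
      Set.countable_empty (fun s hs => (hdiff s hs).continuousAt.continuousWithinAt)
      (fun s hs => hdiff s (Metric.ball_subset_closedBall hs.1))
  have hne : ∀ s ∈ Metric.sphere p r, s - p ≠ 0 := by
    intro s hs h
    rw [mem_sphere_iff_norm, h, norm_zero] at hs
    exact hr.1.ne hs
  have h1 : (∮ s in C(p, r), f s) = 2 * Real.pi * Complex.I * c 0 := by
    rw [circleIntegral.integral_congr hr.1.le
      (g := fun s => principalPart p (N + 1) c s + h s)
      fun s hs => hf s (sub_ne_zero.1 (hne s hs))]
    rw [circleIntegral.integral_add, h0, add_zero, circleIntegral_principalPart p N c hr.1]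
    · refine ContinuousOn.circleIntegrable hr.1.le ?_
      unfold principalPart
      refine continuousOn_finsetSum _ fun j _ => continuousOn_const.mul fun s hs => ?_
      exact ((continuousAt_id.sub continuousAt_const).zpow₀ _
        (Or.inl (hne s hs))).continuousWithinAt
    · exact ContinuousOn.circleIntegrable hr.1.le fun s hs =>
        (hdiff s (Metric.sphere_subset_closedBall hs)).continuousAt.continuousWithinAt
  rw [h1, inv_mul_cancel_left₀ Complex.two_pi_I_ne_zero]

lemma residue_eq_of_simple_pole {f g : ℂ → ℂ} {p : ℂ} (hg : AnalyticAt ℂ g p)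
    (hf : ∀ s ≠ p, f s = (s - p)⁻¹ * g s) : residue f p = g p := by
  have hd : AnalyticAt ℂ (dslope g p) p := by
    obtain ⟨q, hq⟩ := hg
    exact hq.has_fpower_series_dslope_fslope.analyticAt
  refine residue_eq_of_laurent (N := 0) (c := fun _ => g p) hd fun s hs => ?_
  have h0 : s - p ≠ 0 := sub_ne_zero.2 hs
  have h1 := sub_smul_dslope g p s
  rw [smul_eq_mul] at h1
  have h2 : g s = g p + (s - p) * dslope g p s := by rw [h1]; ring
  rw [hf s hs, h2]
  simp [principalPart]
  field_simp

lemma rectIntegral_principalPart {z w p : ℂ} (hp : p ∈ openRect z w) (N : ℕ) (c : ℕ → ℂ) :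
    rectIntegral (principalPart p (N + 1) c) z w = 2 * Real.pi * Complex.I * c 0 := by
  have hre : z.re ≤ w.re := (hp.1.1.trans hp.1.2).le
  have him : z.im ≤ w.im := (hp.2.1.trans hp.2.2).le
  have := rectIntegral_sum (Finset.range (N + 1))
    (fun j s => c j * (s - p) ^ (-(j : ℤ) - 1)) hre him
    fun j _ => continuousOn_const.mul (continuousOn_zpow_rectBoundary hp _)
  change rectIntegral (fun s => ∑ j ∈ Finset.range (N + 1), c j * (s - p) ^ (-(j : ℤ) - 1)) z w = _
  rw [this, Finset.sum_range_succ', Finset.sum_eq_zero, zero_add]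
  · rw [rectIntegral_const_mul]
    simp only [Nat.cast_zero, neg_zero, zero_sub, zpow_neg_one]
    rw [rectIntegral_inv hp]
    ring
  · intro j _
    rw [rectIntegral_const_mul, rectIntegral_zpow hp, mul_zero]
    push_cast
    omega

lemma differentiableAt_principalPart {p s : ℂ} (N : ℕ) (c : ℕ → ℂ) (hs : s ≠ p) :
    DifferentiableAt ℂ (principalPart p N c) s := by
  unfold principalPart
  refine DifferentiableAt.fun_sum fun j _ => DifferentiableAt.const_mul ?_ _
  exact (differentiableAt_id.sub_const p).zpow (Or.inl (sub_ne_zero.2 hs))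

/-- **Residue theorem** for a rectangle. -/
theorem rectIntegral_eq_sum_residue {f : ℂ → ℂ} {z w : ℂ} (hre : z.re ≤ w.re) (him : z.im ≤ w.im)
    (P : Finset ℂ) (hP : ∀ p ∈ P, p ∈ openRect z w)
    (hd : ∀ s ∈ closedRect z w, s ∉ P → DifferentiableAt ℂ f s)
    (hm : ∀ p ∈ P, MeromorphicAt f p) :
    rectIntegral f z w = 2 * Real.pi * Complex.I * ∑ p ∈ P, residue f p := by
  classical
  have hL : ∀ p : ℂ, ∃ N : ℕ, ∃ c : ℕ → ℂ, ∃ h : ℂ → ℂ, p ∈ P → AnalyticAt ℂ h p ∧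
      ∀ s ≠ p, f s = principalPart p (N + 1) c s + h s := by
    intro p
    by_cases hp : p ∈ P
    · obtain ⟨N, c, h, hh⟩ := (hm p hp).exists_laurent
      exact ⟨N, c, h, fun _ => hh⟩
    · exact ⟨0, 0, 0, fun h => absurd h hp⟩
  choose N c h hh using hL
  set pp : ℂ → ℂ → ℂ := fun p => principalPart p (N p + 1) (c p) with hpp
  set k : ℂ → ℂ → ℂ := fun p s => h p s - ∑ q ∈ P.erase p, pp q s with hk
  -- All principal parts are subtracted from `f`. At a pole the value is the one that removes the
  -- singularity: the analytic remainder there minus the principal parts at the other poles.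
  set g : ℂ → ℂ := fun s => if s ∈ P then k s s else f s - ∑ p ∈ P, pp p s with hg
  have hgd : ∀ s ∈ closedRect z w, DifferentiableAt ℂ g s := by
    intro s hs
    by_cases hsP : s ∈ P
    · have h1 : DifferentiableAt ℂ (k s) s := by
        refine (hh s hsP).1.differentiableAt.sub (DifferentiableAt.fun_sum fun q hq => ?_)
        exact differentiableAt_principalPart _ _ (Finset.ne_of_mem_erase hq).symm
      refine h1.congr_of_eventuallyEq ?_
      have hev : ∀ᶠ u in 𝓝 s, u ∉ P.erase s :=
        (P.erase s).finite_toSet.isClosed.isOpen_compl.mem_nhds (by simp)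
      filter_upwards [hev] with u hu
      by_cases hus : u = s
      · subst hus; simp [hg, hsP]
      · have huP : u ∉ P := fun h' => hu (Finset.mem_erase.2 ⟨hus, h'⟩)
        simp only [hg, if_neg huP, hk]
        rw [(hh s hsP).2 u hus, ← Finset.add_sum_erase P _ hsP]
        simp only [hpp]
        ring
    · have h1 : DifferentiableAt ℂ (fun s => f s - ∑ p ∈ P, pp p s) s := by
        refine (hd s hs hsP).sub (DifferentiableAt.fun_sum fun q hq => ?_)
        exact differentiableAt_principalPart _ _ (by rintro rfl; exact hsP hq)
      refine h1.congr_of_eventuallyEq ?_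
      have hev : ∀ᶠ u in 𝓝 s, u ∉ P := P.finite_toSet.isClosed.isOpen_compl.mem_nhds (by simpa)
      filter_upwards [hev] with u hu
      simp [hg, hu]
  have hppc : ∀ p ∈ P, ContinuousOn (pp p) (rectBoundary z w) := fun p hp s hs =>
    (differentiableAt_principalPart _ _
      (ne_of_mem_rectBoundary (hP p hp) hs)).continuousAt.continuousWithinAt
  have e1 : rectIntegral f z w = rectIntegral (fun s => g s + ∑ p ∈ P, pp p s) z w := by
    refine rectIntegral_congr hre him fun s hs => ?_
    have hsP : s ∉ P := fun h' => hs.2 (hP s h')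
    simp [hg, hsP]
  rw [e1, rectIntegral_add hre him
    (fun s hs => (hgd s hs.1).continuousAt.continuousWithinAt) (continuousOn_finsetSum P hppc),
    rectIntegral_eq_zero hre him hgd, zero_add, rectIntegral_sum P pp hre him hppc, Finset.mul_sum]
  refine Finset.sum_congr rfl fun p hp => ?_
  rw [residue_eq_of_laurent (hh p hp).1 (hh p hp).2]
  exact rectIntegral_principalPart (hP p hp) _ _

/-! ### The truncated Perron integral -/

/-- The integral of `y^s / s` over the segment from `1 - iT` to `1 + iT`, without the factor `i`. -/
noncomputable def perronInt (y T : ℝ) : ℂ :=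
  ∫ t : ℝ in -T..T, (y : ℂ) ^ (1 + t * Complex.I) / (1 + t * Complex.I)

/-- The limit of the truncated Perron integrals. -/
noncomputable def perronLimit (y : ℝ) : ℝ :=
  if y < 1 then 0 else if y = 1 then Real.pi else 2 * Real.pi

/-- The point is that the bound does not depend on `b`, which will tend to infinity. -/
lemma integral_const_rpow_le {y b : ℝ} (hy0 : 0 < y) (hy1 : y < 1) :
    ∫ x : ℝ in 1..b, y ^ x ≤ y / -Real.log y := by
  have hlog : Real.log y < 0 := Real.log_neg hy0 hy1
  have h : ∫ x : ℝ in 1..b, y ^ x = y ^ b / Real.log y - y ^ (1 : ℝ) / Real.log y := by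
    refine intervalIntegral.integral_eq_sub_of_hasDerivAt (f := fun x : ℝ => y ^ x / Real.log y)
      (fun x _ => ?_) ?_
    · have := ((Real.hasStrictDerivAt_const_rpow hy0 x).hasDerivAt).div_const (Real.log y)
      rwa [mul_div_cancel_right₀ _ hlog.ne] at this
    · exact (Continuous.rpow continuous_const continuous_id
        fun _ => Or.inl hy0.ne').intervalIntegrable _ _
  rw [h, Real.rpow_one, div_neg]
  have : y ^ b / Real.log y ≤ 0 := div_nonpos_of_nonneg_of_nonpos (Real.rpow_nonneg hy0.le b) hlog.le
  linarith

lemma norm_cpow_div_le {y x τ : ℝ} (hy0 : 0 < y) (hτ : τ ≠ 0) :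
    ‖(y : ℂ) ^ (x + τ * Complex.I) / (x + τ * Complex.I)‖ ≤ y ^ x / |τ| := by
  rw [norm_div, Complex.norm_cpow_eq_rpow_re_of_pos hy0]
  have h1 : |τ| ≤ ‖(x : ℂ) + τ * Complex.I‖ := by
    simpa using Complex.abs_im_le_norm (x + τ * Complex.I)
  have h2 : ((x : ℂ) + τ * Complex.I).re = x := by simp
  rw [h2]
  exact div_le_div_of_nonneg_left (Real.rpow_nonneg hy0.le x) (abs_pos.2 hτ) h1

lemma norm_integral_horizontal_le {y b τ : ℝ} (hy0 : 0 < y) (hy1 : y < 1) (hb : 1 ≤ b)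
    (hτ : τ ≠ 0) :
    ‖∫ x : ℝ in 1..b, (y : ℂ) ^ (x + τ * Complex.I) / (x + τ * Complex.I)‖ ≤
      y / -Real.log y / |τ| := by
  calc _ ≤ ∫ x : ℝ in 1..b, y ^ x / |τ| := by
        refine intervalIntegral.norm_integral_le_of_norm_le hb
          (Eventually.of_forall fun x _ => norm_cpow_div_le hy0 hτ) ?_
        exact ((Continuous.rpow continuous_const continuous_id
          fun _ => Or.inl hy0.ne').div_const _).intervalIntegrable _ _
    _ = (∫ x : ℝ in 1..b, y ^ x) / |τ| := intervalIntegral.integral_div _ _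
    _ ≤ _ := div_le_div_of_nonneg_right (integral_const_rpow_le hy0 hy1) (abs_nonneg τ)

lemma differentiableAt_cpow_div {y : ℝ} (hy0 : 0 < y) {s : ℂ} (hs : s ≠ 0) :
    DifferentiableAt ℂ (fun s : ℂ => (y : ℂ) ^ s / s) s :=
  (differentiableAt_id.const_cpow (Or.inl (Complex.ofReal_ne_zero.2 hy0.ne'))).div
    differentiableAt_id hs

/-- For `y < 1` the contour is pushed to the right, where no pole is met. The side `Re s = b` decays
like `y ^ b`, and the horizontal sides are bounded uniformly in `b`. -/
lemma norm_perronInt_le {y T : ℝ} (hy0 : 0 < y) (hy1 : y < 1) (hT : 0 < T) :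
    ‖perronInt y T‖ ≤ 2 * (y / -Real.log y / T) := by
  have hB : ∀ b : ℝ, 1 ≤ b → ‖perronInt y T‖ ≤ 2 * (y / -Real.log y / T) + 2 * T * y ^ b := by
    intro b hb
    have h0 := rectIntegral_eq_zero (f := fun s : ℂ => (y : ℂ) ^ s / s) (z := ⟨1, -T⟩) (w := ⟨b, T⟩)
      hb (by simp; linarith) (fun s hs => differentiableAt_cpow_div hy0 (by
        rintro rfl
        have := hs.1.1
        simp at this
        linarith))
    simp only [rectIntegral] at h0
    have hbot := norm_integral_horizontal_le (τ := -T) hy0 hy1 hb (by linarith)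
    have htop := norm_integral_horizontal_le (τ := T) hy0 hy1 hb hT.ne'
    rw [abs_neg, abs_of_pos hT] at hbot
    rw [abs_of_pos hT] at htop
    have hright : ‖∫ t : ℝ in -T..T, (y : ℂ) ^ (b + t * Complex.I) / (b + t * Complex.I)‖ ≤
        y ^ b * |T - -T| := by
      refine intervalIntegral.norm_integral_le_of_norm_le_const fun t _ => ?_
      rw [norm_div, Complex.norm_cpow_eq_rpow_re_of_pos hy0]
      have h2 : ((b : ℂ) + t * Complex.I).re = b := by simp
      have h1 : 1 ≤ ‖(b : ℂ) + t * Complex.I‖ := by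
        have := Complex.abs_re_le_norm ((b : ℂ) + t * Complex.I)
        rw [h2] at this
        exact (hb.trans (le_abs_self b)).trans this
      rw [h2]
      exact div_le_self (Real.rpow_nonneg hy0.le b) h1
    rw [show T - -T = 2 * T by ring, abs_of_pos (by linarith)] at hright
    have e : Complex.I * perronInt y T =
        ((∫ x : ℝ in 1..b, (y : ℂ) ^ (x + (-T : ℝ) * Complex.I) / (x + (-T : ℝ) * Complex.I)) -
        (∫ x : ℝ in 1..b, (y : ℂ) ^ (x + T * Complex.I) / (x + T * Complex.I))) +
        Complex.I * ∫ t : ℝ in -T..T, (y : ℂ) ^ (b + t * Complex.I) / (b + t * Complex.I) := by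
      unfold perronInt
      simp only [Complex.ofReal_one] at h0
      linear_combination -h0
    calc ‖perronInt y T‖ = ‖Complex.I * perronInt y T‖ := by simp
      _ ≤ (y / -Real.log y / T + y / -Real.log y / T) + y ^ b * (2 * T) := by
        rw [e]
        refine (norm_add_le _ _).trans (add_le_add ((norm_sub_le _ _).trans
          (add_le_add hbot htop)) ?_)
        simpa using hright
      _ = _ := by ring
  have hlim : Tendsto (fun b : ℝ => 2 * (y / -Real.log y / T) + 2 * T * y ^ b) atTop
      (𝓝 (2 * (y / -Real.log y / T) + 2 * T * 0)) :=
    tendsto_const_nhds.add ((tendsto_rpow_atTop_of_base_lt_one y (by linarith) hy1).const_mul _)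
  rw [mul_zero, add_zero] at hlim
  exact ge_of_tendsto hlim ((eventually_ge_atTop 1).mono hB)

lemma residue_cpow_div {y : ℝ} (hy0 : 0 < y) : residue (fun s : ℂ => (y : ℂ) ^ s / s) 0 = 1 := by
  have hg : AnalyticAt ℂ (fun s : ℂ => (y : ℂ) ^ s) 0 := by
    refine Complex.analyticAt_iff_eventually_differentiableAt.2 (Eventually.of_forall fun s => ?_)
    exact differentiableAt_id.const_cpow (Or.inl (Complex.ofReal_ne_zero.2 hy0.ne'))
  rw [residue_eq_of_simple_pole hg fun s _ => by rw [sub_zero, div_eq_inv_mul]]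
  simp

lemma integral_left_eq_neg_perronInt {y : ℝ} (hy0 : 0 < y) (T : ℝ) :
    ∫ t : ℝ in -T..T, (y : ℂ) ^ (-1 + t * Complex.I) / (-1 + t * Complex.I) =
      -perronInt y⁻¹ T := by
  have h := intervalIntegral.integral_comp_neg (a := -T) (b := T)
    (fun t : ℝ => (y : ℂ) ^ (-1 + t * Complex.I) / (-1 + t * Complex.I))
  rw [neg_neg] at h
  rw [← h, perronInt, ← intervalIntegral.integral_neg]
  refine intervalIntegral.integral_congr fun t _ => ?_
  have e : (-1 + ((-t : ℝ) : ℂ) * Complex.I) = -(1 + t * Complex.I) := by push_cast; ring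
  simp only [e]
  rw [Complex.cpow_neg, Complex.ofReal_inv, Complex.inv_cpow, div_neg]
  rw [Complex.arg_ofReal_of_nonneg hy0.le]
  exact Real.pi_pos.ne

lemma rpow_le_add_inv {y x : ℝ} (hy0 : 0 < y) (hx : x ∈ Set.Icc (-1 : ℝ) 1) :
    y ^ x ≤ y + y⁻¹ := by
  have hi : 0 < y⁻¹ := inv_pos.2 hy0
  rcases le_total 1 y with h | h
  · have := Real.rpow_le_rpow_of_exponent_le h hx.2
    rw [Real.rpow_one] at this
    linarith
  · have := Real.rpow_le_rpow_of_exponent_ge hy0 h hx.1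
    rw [Real.rpow_neg_one] at this
    linarith

/-- The residue theorem around the pole at `0`, whose residue is `1`; the left side is the Perron
integral of `y⁻¹` after `s ↦ -s`. This settles `y = 1` by symmetry and reduces `y > 1` to `y < 1`.
-/
lemma norm_perronInt_add_inv_le {y T : ℝ} (hy0 : 0 < y) (hT : 0 < T) :
    ‖perronInt y T + perronInt y⁻¹ T - 2 * Real.pi‖ ≤ 4 * (y + y⁻¹) / T := by
  have h0 := rectIntegral_eq_sum_residue (f := fun s : ℂ => (y : ℂ) ^ s / s)
    (z := ⟨-1, -T⟩) (w := ⟨1, T⟩) (by simp) (by simp; linarith) {0}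
    (fun p hp => by
      rw [Finset.mem_singleton] at hp
      subst hp
      exact ⟨by simp, by simpa using hT⟩)
    (fun s _ hs => differentiableAt_cpow_div hy0 (by simpa using hs))
    (fun p hp => by
      have hg : AnalyticAt ℂ (fun s : ℂ => (y : ℂ) ^ s) p := by
        refine Complex.analyticAt_iff_eventually_differentiableAt.2
          (Eventually.of_forall fun s => ?_)
        exact differentiableAt_id.const_cpow (Or.inl (Complex.ofReal_ne_zero.2 hy0.ne'))
      exact hg.meromorphicAt.div (MeromorphicAt.id p))
  rw [Finset.sum_singleton, residue_cpow_div hy0] at h0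
  simp only [rectIntegral] at h0
  have hhor : ∀ τ : ℝ, τ ≠ 0 →
      ‖∫ x : ℝ in (-1)..1, (y : ℂ) ^ (x + τ * Complex.I) / (x + τ * Complex.I)‖ ≤
        (y + y⁻¹) / |τ| * |1 - -1| := by
    intro τ hτ
    refine intervalIntegral.norm_integral_le_of_norm_le_const fun x hx => ?_
    rw [Set.uIoc_of_le (by norm_num)] at hx
    exact (norm_cpow_div_le hy0 hτ).trans (div_le_div_of_nonneg_right
      (rpow_le_add_inv hy0 ⟨hx.1.le, hx.2⟩) (abs_nonneg τ))
  have hbot := hhor (-T) (by linarith)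
  have htop := hhor T hT.ne'
  rw [abs_neg, abs_of_pos hT] at hbot
  rw [abs_of_pos hT] at htop
  have hleft := integral_left_eq_neg_perronInt hy0 T
  have e : Complex.I * (perronInt y T + perronInt y⁻¹ T - 2 * Real.pi) =
      (∫ x : ℝ in (-1)..1, (y : ℂ) ^ (x + T * Complex.I) / (x + T * Complex.I)) -
      ∫ x : ℝ in (-1)..1, (y : ℂ) ^ (x + (-T : ℝ) * Complex.I) / (x + (-T : ℝ) * Complex.I) := by
    simp only [Complex.ofReal_one, Complex.ofReal_neg] at h0 hleft ⊢
    rw [hleft] at h0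
    unfold perronInt at h0 ⊢
    linear_combination h0
  calc _ = ‖Complex.I * (perronInt y T + perronInt y⁻¹ T - 2 * Real.pi)‖ := by simp
    _ ≤ (y + y⁻¹) / T * |1 - -1| + (y + y⁻¹) / T * |1 - -1| := by
      rw [e]
      exact (norm_sub_le _ _).trans (add_le_add htop hbot)
    _ = _ := by norm_num; ring

lemma tendsto_perronInt_of_lt_one {y : ℝ} (hy0 : 0 < y) (hy1 : y < 1) :
    Tendsto (perronInt y) atTop (𝓝 0) := by
  refine squeeze_zero_norm' ((eventually_gt_atTop 0).mono fun T hT =>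
    norm_perronInt_le hy0 hy1 hT) ?_
  have h : Tendsto (fun T : ℝ => y / -Real.log y / T) atTop (𝓝 0) :=
    tendsto_const_nhds.div_atTop tendsto_id
  simpa using h.const_mul 2

lemma tendsto_perronInt_add_inv {y : ℝ} (hy0 : 0 < y) :
    Tendsto (fun T => perronInt y T + perronInt y⁻¹ T) atTop (𝓝 (2 * Real.pi)) := by
  refine tendsto_sub_nhds_zero_iff.1 (squeeze_zero_norm' ((eventually_gt_atTop 0).mono
    fun T hT => norm_perronInt_add_inv_le hy0 hT) ?_)
  exact tendsto_const_nhds.div_atTop tendsto_id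

theorem tendsto_perronInt {y : ℝ} (hy0 : 0 < y) :
    Tendsto (perronInt y) atTop (𝓝 (perronLimit y : ℂ)) := by
  unfold perronLimit
  split_ifs with h1 h2
  · simpa using tendsto_perronInt_of_lt_one hy0 h1
  · subst h2
    have h := (tendsto_perronInt_add_inv one_pos).div_const 2
    simp only [inv_one, add_self_div_two] at h
    simpa using h
  · have h3 : 1 < y := lt_of_le_of_ne (not_lt.1 h1) (Ne.symm h2)
    have h := (tendsto_perronInt_add_inv hy0).sub
      (tendsto_perronInt_of_lt_one (inv_pos.2 hy0) (inv_lt_one_of_one_lt₀ h3))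
    simpa using h

theorem tendsto_tsum_perronInt {ι : Type*} {y : ι → ℝ} (hy : ∀ i, 0 < y i) (hs : Summable y) :
    Tendsto (fun T => ∑' i, perronInt (y i) T) atTop (𝓝 (∑' i, (perronLimit (y i) : ℂ))) := by
  classical
  have hfin : {i | ¬ y i < 1 / 2}.Finite :=
    hs.tendsto_cofinite_zero.eventually (gt_mem_nhds (by norm_num))
  set S := hfin.toFinset with hS
  -- A dominating family for large `T`. Only finitely many `y i` are at least `1 / 2`, and their
  -- integrals are eventually within `1` of the limit in norm; for the others `-log (y i) ≥ 1 / 2`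
  -- turns `norm_perronInt_le` into the bound `4 * y i`.
  set B : ι → ℝ := fun i => if i ∈ S then |perronLimit (y i)| + 1 else 4 * y i with hB
  have hBs : Summable B := by
    refine (hs.mul_left 4).congr_cofinite ?_
    filter_upwards [S.finite_toSet.compl_mem_cofinite] with i hi
    have : i ∉ S := by simpa using hi
    simp [hB, this]
  refine tendsto_tsum_of_dominated_convergence hBs (fun i => tendsto_perronInt (hy i)) ?_
  have h1 : ∀ᶠ T in atTop, ∀ i ∈ S, ‖perronInt (y i) T‖ ≤ |perronLimit (y i)| + 1 := by
    rw [Filter.eventually_all_finset]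
    intro i _
    have := (tendsto_perronInt (hy i)).norm
    rw [Complex.norm_real, Real.norm_eq_abs] at this
    exact this.eventually_le_const (lt_add_one _)
  filter_upwards [h1, eventually_ge_atTop 1] with T hT1 hT i
  by_cases hi : i ∈ S
  · simpa [hB, hi] using hT1 i hi
  · have hlt : y i < 1 / 2 := by simpa [hS] using hi
    have hlog : 1 / 2 ≤ -Real.log (y i) := by
      rw [← Real.log_inv]
      have h2 : (2 : ℝ) ≤ (y i)⁻¹ := by
        rw [le_inv_comm₀ two_pos (hy i)]; linarith
      have := Real.log_le_log two_pos h2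
      have := Real.log_two_gt_d9
      linarith
    have hb := norm_perronInt_le (hy i) (hlt.trans (by norm_num)) (by linarith : 0 < T)
    simp only [hB, if_neg hi]
    refine hb.trans ?_
    have h3 : y i / -Real.log (y i) / T ≤ y i / -Real.log (y i) :=
      div_le_self (div_nonneg (hy i).le (by linarith)) hT
    have h4 : y i / -Real.log (y i) ≤ y i / (1 / 2) :=
      div_le_div_of_nonneg_left (hy i).le (by norm_num) hlog
    linarith

/-- Sum and integral are interchanged by dominated convergence: on `Re s = 1` one has `|s| ≥ 1`, so
each term is at most `y i`. -/
lemma hasSum_perronInt {ι : Type*} [Countable ι] {y : ι → ℝ} (hy : ∀ i, 0 < y i)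
    (hs : Summable y) {F : ℝ → ℂ} (T : ℝ)
    (hF : ∀ t : ℝ, HasSum (fun i => (y i : ℂ) ^ (1 + t * Complex.I) / (1 + t * Complex.I)) (F t)) :
    HasSum (fun i => perronInt (y i) T) (∫ t : ℝ in -T..T, F t) := by
  have hne : ∀ t : ℝ, (1 + t * Complex.I : ℂ) ≠ 0 := fun t h => by
    simpa using congrArg Complex.re h
  refine intervalIntegral.hasSum_integral_of_dominated_convergence (fun i _ => y i)
    (fun i => ?_) (fun i => Eventually.of_forall fun t _ => ?_)
    (Eventually.of_forall fun t _ => hs) (by simp) (Eventually.of_forall fun t _ => hF t)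
  · refine Continuous.aestronglyMeasurable ?_
    refine Continuous.div ?_ (by fun_prop) hne
    exact Continuous.const_cpow (by fun_prop) (Or.inl (Complex.ofReal_ne_zero.2 (hy i).ne'))
  · rw [norm_div, Complex.norm_cpow_eq_rpow_re_of_pos (hy i)]
    have h1 : 1 ≤ ‖(1 + t * Complex.I : ℂ)‖ := by
      simpa using Complex.abs_re_le_norm (1 + t * Complex.I)
    have h2 : (1 + t * Complex.I : ℂ).re = 1 := by simp
    rw [h2, Real.rpow_one]
    exact div_le_self (hy i).le h1

/-! ### Exponent vectors and the Euler product -/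

section euler

variable {n : ℕ} {a : Fin n → ℕ}

lemma powerProduct_pos (ha : ∀ k, (a k).Prime) (q : Fin n → ℕ) : 0 < powerProduct a q :=
  Finset.prod_pos fun k _ => pow_pos (ha k).pos _

lemma factorization_powerProduct (ha : ∀ k, (a k).Prime) (hinj : Function.Injective a)
    (q : Fin n → ℕ) (j : Fin n) : (powerProduct a q).factorization (a j) = q j := by
  unfold powerProduct
  rw [Nat.factorization_prod fun k _ => pow_ne_zero _ (ha k).ne_zero, Finsupp.finsetSum_apply,
    Finset.sum_eq_single j]
  · rw [(ha j).factorization_pow, Finsupp.single_eq_same]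
  · intro k _ hk
    rw [(ha k).factorization_pow, Finsupp.single_eq_of_ne]
    exact fun h => hk (hinj h.symm)
  · simp

lemma powerProduct_injective (ha : ∀ k, (a k).Prime) (hinj : Function.Injective a) :
    Function.Injective (powerProduct a) := fun q q' h => by
  ext j
  rw [← factorization_powerProduct ha hinj q j, h, factorization_powerProduct ha hinj q' j]

lemma powerProduct_mem_factoredNumbers (ha : ∀ k, (a k).Prime) (q : Fin n → ℕ) :
    powerProduct a q ∈ Nat.factoredNumbers (Finset.univ.image a) := by
  rw [Nat.mem_factoredNumbers']
  intro p hp hdvd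
  unfold powerProduct at hdvd
  obtain ⟨k, _, hk⟩ := (Prime.dvd_finsetProd_iff hp.prime _).1 hdvd
  have := (Nat.prime_dvd_prime_iff_eq hp (ha k)).1 (hp.dvd_of_dvd_pow hk)
  rw [this]
  exact Finset.mem_image_of_mem a (Finset.mem_univ k)

lemma exists_powerProduct_eq (hinj : Function.Injective a) {m : ℕ}
    (hm : m ∈ Nat.factoredNumbers (Finset.univ.image a)) : ∃ q, powerProduct a q = m := by
  refine ⟨fun k => m.factorization (a k), ?_⟩
  have h0 := Nat.ne_zero_of_mem_factoredNumbers hm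
  conv_rhs => rw [← Nat.prod_factorization_pow_eq_self h0]
  rw [Finsupp.prod_of_support_subset (s := Finset.univ.image a)]
  · rw [Finset.prod_image hinj.injOn]
    rfl
  · rw [Nat.support_factorization]
    exact Nat.primeFactors_subset_of_mem_factoredNumbers hm
  · simp

/-- Exponent vectors correspond to the numbers all of whose prime factors are among the `a k`. -/
noncomputable def exponentEquiv (ha : ∀ k, (a k).Prime) (hinj : Function.Injective a) :
    (Fin n → ℕ) ≃ Nat.factoredNumbers (Finset.univ.image a) :=
  Equiv.ofBijective (fun q => ⟨powerProduct a q, powerProduct_mem_factoredNumbers ha q⟩)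
    ⟨fun _ _ h => powerProduct_injective ha hinj (congrArg Subtype.val h), fun m =>
      (exists_powerProduct_eq hinj m.2).imp fun _ h => Subtype.ext h⟩

/-- A product of finitely many geometric series, which is why `Re s > 0` suffices; the sum over
integers with all prime factors among the `a k` is transported by `exponentEquiv`. -/
lemma euler_product (ha : ∀ k, (a k).Prime) (hinj : Function.Injective a) {s : ℂ}
    (hs : 0 < s.re) :
    (Summable fun q => ‖(powerProduct a q : ℂ) ^ (-s)‖) ∧
      HasSum (fun q => (powerProduct a q : ℂ) ^ (-s)) (∏ k, (1 - 1 / (a k : ℂ) ^ s)⁻¹) := by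
  have hs0 : s ≠ 0 := by rintro rfl; simp at hs
  have hlt : ∀ {p : ℕ}, p.Prime → ‖(riemannZetaSummandHom hs0 : ℕ →* ℂ) p‖ < 1 := by
    intro p hp
    change ‖(p : ℂ) ^ (-s)‖ < 1
    rw [Complex.norm_natCast_cpow_of_pos hp.pos]
    exact Real.rpow_lt_one_of_one_lt_of_neg (by exact_mod_cast hp.one_lt) (by simpa using hs)
  obtain ⟨h1, h2⟩ :=
    EulerProduct.summable_and_hasSum_factoredNumbers_prod_filter_prime_geometric hlt
      (Finset.univ.image a)
  refine ⟨(exponentEquiv ha hinj).summable_iff.2 h1, ?_⟩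
  have h3 := (exponentEquiv ha hinj).hasSum_iff.2 h2
  have h4 : ∏ p ∈ Finset.univ.image a with p.Prime,
      (1 - (riemannZetaSummandHom hs0 : ℕ →* ℂ) p)⁻¹ = ∏ k, (1 - 1 / (a k : ℂ) ^ s)⁻¹ := by
    rw [Finset.filter_true_of_mem (by simpa using ha), Finset.prod_image hinj.injOn]
    refine Finset.prod_congr rfl fun k _ => ?_
    change (1 - (a k : ℂ) ^ (-s))⁻¹ = _
    rw [Complex.cpow_neg, one_div]
  rw [h4] at h3
  exact h3

lemma summable_div_powerProduct (ha : ∀ k, (a k).Prime) (hinj : Function.Injective a) (x : ℝ) :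
    Summable fun q => x / (powerProduct a q : ℝ) := by
  have h := (euler_product ha hinj (s := 1) (by simp)).1
  refine (h.mul_left x).congr fun q => ?_
  rw [Complex.cpow_neg_one, norm_inv, Complex.norm_natCast, div_eq_mul_inv]

lemma hasSum_perronIntegrand (ha : ∀ k, (a k).Prime) (hinj : Function.Injective a) {x : ℝ}
    (hx : 0 < x) {s : ℂ} (hs : 0 < s.re) :
    HasSum (fun q => ((x / powerProduct a q : ℝ) : ℂ) ^ s / s) (perronIntegrand a x s) := by
  have h := ((euler_product ha hinj hs).2).mul_left ((x : ℂ) ^ s / s)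
  have e : (x : ℂ) ^ s / s * ∏ k, (1 - 1 / (a k : ℂ) ^ s)⁻¹ = perronIntegrand a x s := by
    unfold perronIntegrand
    rw [Finset.prod_inv_distrib]
    field_simp
  rw [e] at h
  have e2 : (fun q => ((x / powerProduct a q : ℝ) : ℂ) ^ s / s) =
      fun q => (x : ℂ) ^ s / s * (powerProduct a q : ℂ) ^ (-s) := by
    funext q
    rw [Complex.ofReal_div, Complex.div_cpow_ofReal_nonneg hx.le (Nat.cast_nonneg _),
      Complex.ofReal_natCast, Complex.cpow_neg]
    ring
  rw [e2]
  exact h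

lemma finite_powerProduct_le (ha : ∀ k, (a k).Prime) (hinj : Function.Injective a) (x : ℝ) :
    {q : Fin n → ℕ | (powerProduct a q : ℝ) ≤ x}.Finite := by
  refine Set.Finite.of_finite_image (f := powerProduct a) ((Set.finite_Iic ⌊x⌋₊).subset ?_)
    (powerProduct_injective ha hinj).injOn
  rintro _ ⟨q, hq, rfl⟩
  exact Nat.le_floor hq

/-- Every vector with product at most `x` contributes `2π`, except that equality contributes only
`π`; by unique factorization equality occurs for at most one vector. -/
lemma tsum_perronLimit (ha : ∀ k, (a k).Prime) (hinj : Function.Injective a) (x : ℝ) :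
    ∑' q, perronLimit (x / powerProduct a q) =
      2 * Real.pi * countProducts a x - Real.pi * productChi a x := by
  classical
  have hfin := finite_powerProduct_le ha hinj x
  have hpos : ∀ q, (0 : ℝ) < powerProduct a q := fun q => by exact_mod_cast powerProduct_pos ha q
  have hterm : ∀ q ∈ hfin.toFinset, perronLimit (x / powerProduct a q) =
      2 * Real.pi - Real.pi * if (powerProduct a q : ℝ) = x then 1 else 0 := by
    intro q hq
    have hq' : (powerProduct a q : ℝ) ≤ x := by simpa using hq
    unfold perronLimit
    rw [if_neg (not_lt.2 ((one_le_div (hpos q)).2 hq'))]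
    by_cases h : (powerProduct a q : ℝ) = x
    · rw [if_pos ((div_eq_one_iff_eq (hpos q).ne').2 h.symm), if_pos h]; ring
    · rw [if_neg (fun h' => h ((div_eq_one_iff_eq (hpos q).ne').1 h').symm), if_neg h]; ring
  rw [tsum_eq_sum (s := hfin.toFinset), Finset.sum_congr rfl hterm, Finset.sum_sub_distrib,
    Finset.sum_const, nsmul_eq_mul, ← Set.ncard_eq_toFinset_card _ hfin]
  · have hchi : (∑ q ∈ hfin.toFinset, if (powerProduct a q : ℝ) = x then (1 : ℝ) else 0) =
        productChi a x := by
      unfold productChi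
      by_cases h : x ∈ productSet a
      · rw [Set.indicator_of_mem h]
        obtain ⟨q₀, hq₀⟩ := h
        rw [ Finset.sum_eq_single q₀]
        · exact if_pos hq₀
        · intro q _ hq
          refine if_neg fun h => hq (powerProduct_injective ha hinj ?_)
          simp only at hq₀
          exact_mod_cast h.trans hq₀.symm
        · intro h'
          exact absurd hq₀.le (by simpa using h')
      · rw [Set.indicator_of_notMem h]
        exact Finset.sum_eq_zero fun q _ => if_neg fun h' => h ⟨q, h'⟩
    rw [← Finset.mul_sum, hchi]
    unfold countProducts
    ring
  · intro q hq
    have hq' : x < powerProduct a q := by simpa using hq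
    unfold perronLimit
    rw [if_pos ((div_lt_one (hpos q)).2 hq')]

lemma tendsto_integral_perronIntegrand (ha : ∀ k, (a k).Prime) (hinj : Function.Injective a)
    {x : ℝ} (hx : 0 < x) :
    Tendsto (fun T => ∫ t : ℝ in -T..T, perronIntegrand a x (1 + t * Complex.I)) atTop
      (𝓝 ((2 * Real.pi * countProducts a x - Real.pi * productChi a x : ℝ) : ℂ)) := by
  have hy : ∀ q, 0 < x / powerProduct a q := fun q =>
    div_pos hx (by exact_mod_cast powerProduct_pos ha q)
  have hs := summable_div_powerProduct ha hinj x
  have h := tendsto_tsum_perronInt hy hs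
  rw [← Complex.ofReal_tsum, tsum_perronLimit ha hinj] at h
  refine h.congr fun T => ?_
  exact (hasSum_perronInt hy hs T fun t =>
    hasSum_perronIntegrand ha hinj hx (by simp)).tsum_eq

lemma natCast_prod_cpow {ι : Type*} (S : Finset ι) (b : ι → ℕ) (s : ℂ) :
    ((∏ k ∈ S, b k : ℕ) : ℂ) ^ s = ∏ k ∈ S, (b k : ℂ) ^ s := by
  classical
  induction S using Finset.induction_on with
  | empty => simp
  | insert k S hk ih =>
    rw [Finset.prod_insert hk, Finset.prod_insert hk, Nat.cast_mul,
      Complex.natCast_mul_natCast_cpow, ih]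

/-- From `1 - p^s = -p^s (1 - p^{-s})`: the `n` factors give `(-1)^n` and `∏ p^s`, and `1 / s` gives
one more sign. -/
lemma perronIntegrand_neg (ha : ∀ k, (a k).Prime) {x : ℝ} (hx : 0 < x) (s : ℂ) :
    perronIntegrand a x (-s) =
      (-1) ^ (n + 1) * perronIntegrand a (x * ∏ k, (a k : ℝ))⁻¹ s := by
  have hP : (0 : ℝ) < ∏ k, (a k : ℝ) := Finset.prod_pos fun k _ => by
    exact_mod_cast (ha k).pos
  have h1 : (((x * ∏ k, (a k : ℝ))⁻¹ : ℝ) : ℂ) ^ s = (x : ℂ) ^ (-s) * (∏ k, (a k : ℂ) ^ s)⁻¹ := by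
    have h2 : ((∏ k, (a k : ℝ) : ℝ) : ℂ) ^ s = ∏ k, (a k : ℂ) ^ s := by
      rw [← natCast_prod_cpow]
      push_cast
      rfl
    rw [Complex.ofReal_inv, Complex.inv_cpow, Complex.ofReal_mul,
      Complex.mul_cpow_ofReal_nonneg hx.le hP.le, Complex.cpow_neg, h2, mul_inv]
    rw [Complex.arg_ofReal_of_nonneg (by positivity)]
    exact Real.pi_pos.ne
  have h3 : ∏ k, (1 - 1 / (a k : ℂ) ^ (-s)) =
      (-1) ^ n * ((∏ k, (a k : ℂ) ^ s) * ∏ k, (1 - 1 / (a k : ℂ) ^ s)) := by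
    rw [← Finset.prod_mul_distrib]
    have : ((-1 : ℂ)) ^ n = ∏ _k : Fin n, (-1 : ℂ) := by simp
    rw [this, ← Finset.prod_mul_distrib]
    refine Finset.prod_congr rfl fun k _ => ?_
    have h0 : (a k : ℂ) ^ s ≠ 0 := by
      rw [Ne, Complex.cpow_eq_zero_iff]
      exact fun h => (ha k).ne_zero (by exact_mod_cast h.1)
    rw [Complex.cpow_neg]
    field_simp
    ring
  have h4 : ((-1 : ℂ) ^ n)⁻¹ = (-1) ^ n := by rw [← inv_pow]; norm_num
  unfold perronIntegrand
  rw [h1, h3, div_eq_mul_inv, div_eq_mul_inv, mul_inv, mul_inv, mul_inv, mul_inv, h4, inv_neg]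
  ring

lemma tendsto_integral_perronIntegrand_left (ha : ∀ k, (a k).Prime)
    (hinj : Function.Injective a) (hn : 1 ≤ n) {x : ℝ} (hx : 1 ≤ x) :
    Tendsto (fun T => ∫ t : ℝ in -T..T, perronIntegrand a x (-1 + t * Complex.I)) atTop
      (𝓝 0) := by
  set y : ℝ := (x * ∏ k, (a k : ℝ))⁻¹ with hy
  -- `1 ≤ n` makes this strict, which matters at `x = 1`: with `y = 1` the empty product would be
  -- counted.
  have hPone : (1 : ℝ) < ∏ k, (a k : ℝ) := by
    have : 1 < ∏ k, a k := by
      exact lt_of_lt_of_le (ha ⟨0, hn⟩).one_lt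
        (Finset.single_le_prod' (fun k _ => (ha k).pos) (Finset.mem_univ _))
    exact_mod_cast this
  have hxP : 1 < x * ∏ k, (a k : ℝ) := by nlinarith
  have hy0 : 0 < y := inv_pos.2 (by linarith)
  have hy1 : y < 1 := inv_lt_one_of_one_lt₀ hxP
  have h := (tendsto_integral_perronIntegrand ha hinj hy0).const_mul ((-1 : ℂ) ^ (n + 1))
  have hz : 2 * Real.pi * countProducts a y - Real.pi * productChi a y = 0 := by
    rw [← tsum_perronLimit ha hinj]
    have : ∀ q, perronLimit (y / powerProduct a q) = 0 := fun q => by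
      have h1 : (1 : ℝ) ≤ powerProduct a q := by exact_mod_cast powerProduct_pos ha q
      refine if_pos ((div_lt_one (by linarith)).2 (by linarith))
    simp [this]
  rw [hz, Complex.ofReal_zero, mul_zero] at h
  refine h.congr fun T => ?_
  have h2 := intervalIntegral.integral_comp_neg (a := -T) (b := T)
    (fun t : ℝ => perronIntegrand a x (-1 + t * Complex.I))
  rw [neg_neg] at h2
  rw [← h2, ← intervalIntegral.integral_const_mul]
  refine intervalIntegral.integral_congr fun t _ => ?_
  have e : (-1 + ((-t : ℝ) : ℂ) * Complex.I) = -(1 + t * Complex.I) := by push_cast; ring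
  simp only [e]
  rw [perronIntegrand_neg ha (by linarith)]

end euler

/-! ### The integrand on horizontal segments -/

lemma natCast_cpow_eq_exp {b : ℕ} (hb : b ≠ 0) (s : ℂ) :
    (b : ℂ) ^ s = Complex.exp (Real.log b * s) := by
  rw [Complex.cpow_def_of_ne_zero (Nat.cast_ne_zero.2 hb), Complex.natCast_log]

lemma abs_sin_half_le_norm_one_sub {ρ θ : ℝ} (hρ : 0 ≤ ρ) :
    |Real.sin (θ / 2)| ≤ ‖1 - (ρ : ℂ) * Complex.exp (θ * Complex.I)‖ := by
  rw [← abs_norm]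
  refine sq_le_sq.1 ?_
  have h1 : (1 - (ρ : ℂ) * Complex.exp (θ * Complex.I)) =
      ((1 - ρ * Real.cos θ : ℝ) : ℂ) + ((-(ρ * Real.sin θ) : ℝ) : ℂ) * Complex.I := by
    rw [Complex.exp_mul_I]
    push_cast
    ring
  rw [h1, ← Complex.normSq_eq_norm_sq, Complex.normSq_add_mul_I]
  have h2 : Real.cos θ = 1 - 2 * Real.sin (θ / 2) ^ 2 := by
    have h3 := Real.cos_two_mul (θ / 2)
    have h4 := Real.sin_sq_add_cos_sq (θ / 2)
    rw [mul_div_cancel₀ θ two_ne_zero] at h3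
    linarith
  have h5 := Real.sin_sq_add_cos_sq θ
  have h6 : Real.sin (θ / 2) ^ 2 ≤ 1 := Real.sin_sq_le_one _
  have h7 : (1 - ρ * Real.cos θ) ^ 2 + (-(ρ * Real.sin θ)) ^ 2 =
      (1 - ρ) ^ 2 + 4 * ρ * Real.sin (θ / 2) ^ 2 := by
    have : (1 - ρ * Real.cos θ) ^ 2 + (-(ρ * Real.sin θ)) ^ 2 =
        1 - 2 * ρ * Real.cos θ + ρ ^ 2 := by linear_combination ρ ^ 2 * h5
    rw [this, h2]
    ring
  rw [h7]
  -- Replacing `(1 - ρ)²` by `(1 - ρ)² sin²` leaves `(1 + ρ)² sin²`, which is at least `sin²`.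
  nlinarith [mul_nonneg (sq_nonneg (1 - ρ)) (sub_nonneg.2 h6),
    mul_nonneg (sq_nonneg ρ) (sq_nonneg (Real.sin (θ / 2))),
    mul_nonneg hρ (sq_nonneg (Real.sin (θ / 2)))]

/-- Subtract the nearest integer and apply Jordan's inequality `|sin u| ≥ 2|u| / π` on `[-π/2,
π/2]`. -/
lemma two_mul_le_abs_sin_pi_mul {t δ : ℝ} (h : ∀ ν : ℤ, δ ≤ |t - ν|) :
    2 * δ ≤ |Real.sin (Real.pi * t)| := by
  have h1 : |Real.sin (Real.pi * t)| = |Real.sin (Real.pi * (t - round t))| := by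
    have : Real.pi * (t - round t) = Real.pi * t - round t * Real.pi := by ring
    rw [this, Real.sin_sub_int_mul_pi, abs_mul, abs_zpow]
    simp
  have hpi := Real.pi_pos
  have h2 := abs_sub_round t
  have h3 : |Real.pi * (t - round t)| ≤ Real.pi / 2 := by
    rw [abs_mul, abs_of_pos hpi]
    nlinarith
  have h4 := Real.mul_abs_le_abs_sin h3
  rw [abs_mul, abs_of_pos hpi] at h4
  have h5 : 2 / Real.pi * (Real.pi * |t - round t|) = 2 * |t - round t| := by field_simp
  rw [h1]
  have := h (round t)
  linarith

/-- At height `±2πR` the half-angle of `b^{-s}` is `∓πR log b`, so the bound holds whatever the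
modulus, that is, uniformly in `σ`. -/
lemma two_mul_le_norm_one_sub {b : ℕ} (hb : b ≠ 0) {R δ : ℝ}
    (h : ∀ ν : ℤ, δ ≤ |R * Real.log b - ν|) {σ τ : ℝ} (hτ : |τ| = 2 * Real.pi * R) :
    2 * δ ≤ ‖1 - 1 / (b : ℂ) ^ (σ + τ * Complex.I)‖ := by
  have h1 : 1 / (b : ℂ) ^ (σ + τ * Complex.I) =
      ((Real.exp (-(Real.log b * σ)) : ℝ) : ℂ) *
        Complex.exp (((-(Real.log b * τ) : ℝ) : ℂ) * Complex.I) := by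
    rw [natCast_cpow_eq_exp hb, one_div, ← Complex.exp_neg, Complex.ofReal_exp, ← Complex.exp_add]
    congr 1
    push_cast
    ring
  rw [h1]
  refine le_trans ?_ (abs_sin_half_le_norm_one_sub (Real.exp_pos _).le)
  refine (two_mul_le_abs_sin_pi_mul h).trans (le_of_eq ?_)
  rcases abs_choice τ with h2 | h2
  · have : -(Real.log b * τ) / 2 = -(Real.pi * (R * Real.log b)) := by
      rw [← h2, hτ]; ring
    rw [this, Real.sin_neg, abs_neg]
  · have : -(Real.log b * τ) / 2 = Real.pi * (R * Real.log b) := by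
      have : -τ = 2 * Real.pi * R := by rw [← h2, hτ]
      linear_combination (Real.log b / 2) * this
    rw [this]

lemma norm_perronIntegrand_le {n : ℕ} {a : Fin n → ℕ} (ha : ∀ k, a k ≠ 0) {x R δ : ℝ}
    (hx : 0 < x) (hR : 0 < R) (hδ : 0 < δ) (h : ∀ k, ∀ ν : ℤ, δ ≤ |R * Real.log (a k) - ν|)
    {σ τ : ℝ} (hσ : σ ∈ Set.Icc (-1 : ℝ) 1) (hτ : |τ| = 2 * Real.pi * R) :
    ‖perronIntegrand a x (σ + τ * Complex.I)‖ ≤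
      (x + x⁻¹) / (2 * Real.pi * (2 * δ) ^ n) / R := by
  unfold perronIntegrand
  have hpi := Real.pi_pos
  rw [norm_div, norm_mul, norm_prod, Complex.norm_cpow_eq_rpow_re_of_pos hx]
  have h1 : ((σ : ℂ) + τ * Complex.I).re = σ := by simp
  have h2 : 2 * Real.pi * R ≤ ‖(σ : ℂ) + τ * Complex.I‖ := by
    rw [← hτ]
    simpa using Complex.abs_im_le_norm (σ + τ * Complex.I)
  have h3 : (2 * δ) ^ n ≤ ∏ k, ‖1 - 1 / (a k : ℂ) ^ (σ + τ * Complex.I)‖ := by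
    have : (2 * δ) ^ n = ∏ _k : Fin n, 2 * δ := by simp
    rw [this]
    exact Finset.prod_le_prod (fun _ _ => by linarith)
      fun k _ => two_mul_le_norm_one_sub (ha k) (h k) hτ
  rw [h1, div_div]
  refine div_le_div₀ (by positivity) (rpow_le_add_inv hx hσ) (by positivity) ?_
  calc 2 * Real.pi * (2 * δ) ^ n * R = (2 * Real.pi * R) * (2 * δ) ^ n := by ring
    _ ≤ _ := mul_le_mul h2 h3 (by positivity) (norm_nonneg _)

lemma AppropriateCutoffs.tendsto_integral_horizontal {n : ℕ} {a : Fin n → ℕ} (ha : ∀ k, a k ≠ 0)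
    {R : ℕ → ℝ} (hR : AppropriateCutoffs a R) {x : ℝ} (hx : 0 < x) {τ : ℕ → ℝ}
    (hτ : ∀ᶠ j in atTop, |τ j| = 2 * Real.pi * R j) :
    Tendsto (fun j => ∫ σ : ℝ in (-1)..1, perronIntegrand a x (σ + τ j * Complex.I)) atTop
      (𝓝 0) := by
  obtain ⟨hlim, δ, hδ, h⟩ := hR
  refine squeeze_zero_norm' (a := fun j =>
    (x + x⁻¹) / (2 * Real.pi * (2 * δ) ^ n) / R j * |1 - -1|) ?_ ?_
  · filter_upwards [hτ, hlim.eventually_gt_atTop 0] with j hj hRj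
    refine intervalIntegral.norm_integral_le_of_norm_le_const fun σ hσ => ?_
    rw [Set.uIoc_of_le (by norm_num)] at hσ
    exact norm_perronIntegrand_le ha hx hRj hδ (h j) ⟨hσ.1.le, hσ.2⟩ hj
  · have : Tendsto (fun j => (x + x⁻¹) / (2 * Real.pi * (2 * δ) ^ n) / R j) atTop (𝓝 0) :=
      tendsto_const_nhds.div_atTop hlim
    simpa using this.mul_const |(1 : ℝ) - -1|

/-! ### The poles of the integrand -/

/-- The zero `2πiν / log b` of `1 - b^{-s}`. -/
noncomputable def logPole (b : ℕ) (ν : ℤ) : ℂ :=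
  ((2 * Real.pi * ν / Real.log b : ℝ) : ℂ) * Complex.I

lemma logPole_im (b : ℕ) (ν : ℤ) : (logPole b ν).im = 2 * Real.pi * ν / Real.log b := by
  simp only [logPole, Complex.im_ofReal_mul, Complex.I_im, mul_one]

lemma logPole_re (b : ℕ) (ν : ℤ) : (logPole b ν).re = 0 := by
  simp only [logPole, Complex.re_ofReal_mul, Complex.I_re, mul_zero]

lemma log_natCast_pos {b : ℕ} (hb : b.Prime) : 0 < Real.log b :=
  Real.log_pos (by exact_mod_cast hb.one_lt)

lemma one_sub_one_div_cpow_eq_zero_iff {b : ℕ} (hb : b.Prime) {s : ℂ} :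
    1 - 1 / (b : ℂ) ^ s = 0 ↔ ∃ ν : ℤ, s = logPole b ν := by
  have hl : (Real.log b : ℂ) ≠ 0 := Complex.ofReal_ne_zero.2 (log_natCast_pos hb).ne'
  rw [natCast_cpow_eq_exp hb.ne_zero, sub_eq_zero, eq_comm, one_div, inv_eq_one,
    Complex.exp_eq_one_iff]
  refine exists_congr fun ν => ?_
  unfold logPole
  rw [Complex.ofReal_div]
  generalize (Real.log b : ℂ) = c at hl
  push_cast
  constructor
  · intro h
    field_simp
    linear_combination h
  · rintro rfl
    field_simp

/-- Exponentiating the absolute values gives `q^|ν| = p^|μ|`, and unique factorization decides. This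
is what keeps the nonzero poles of different primes apart. -/
lemma eq_of_int_mul_log_eq {p q : ℕ} (hp : p.Prime) (hq : q.Prime) {μ ν : ℤ} (hν : ν ≠ 0)
    (h : ν * Real.log q = μ * Real.log p) : q = p := by
  have h1 : (ν.natAbs : ℝ) * Real.log q = μ.natAbs * Real.log p := by
    have := congrArg abs h
    rw [abs_mul, abs_mul, abs_of_pos (log_natCast_pos hp), abs_of_pos (log_natCast_pos hq)] at this
    rw [Nat.cast_natAbs, Nat.cast_natAbs]
    push_cast
    exact this
  rw [← Real.log_pow, ← Real.log_pow] at h1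
  have h2 : (q : ℝ) ^ ν.natAbs = (p : ℝ) ^ μ.natAbs :=
    Real.log_injOn_pos (Set.mem_Ioi.2 (pow_pos (by exact_mod_cast hq.pos) _))
      (Set.mem_Ioi.2 (pow_pos (by exact_mod_cast hp.pos) _)) h1
  have h3 : q ^ ν.natAbs = p ^ μ.natAbs := by exact_mod_cast h2
  have h4 : q ∣ p ^ μ.natAbs := by
    rw [← h3]
    exact dvd_pow_self q (Int.natAbs_ne_zero.2 hν)
  exact (Nat.prime_dvd_prime_iff_eq hq hp).1 (hq.dvd_of_dvd_pow h4)

lemma logPole_injective {b : ℕ} (hb : b.Prime) : Function.Injective (logPole b) := by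
  intro μ ν h
  have h1 := congrArg Complex.im h
  rw [logPole_im, logPole_im, div_left_inj' (log_natCast_pos hb).ne'] at h1
  have := mul_left_cancel₀ (by positivity : (2 * Real.pi : ℝ) ≠ 0) h1
  exact_mod_cast this

lemma eq_of_logPole_eq {p q : ℕ} (hp : p.Prime) (hq : q.Prime) {μ ν : ℤ} (hν : ν ≠ 0)
    (h : logPole p ν = logPole q μ) : q = p := by
  have h1 := congrArg Complex.im h
  rw [logPole_im, logPole_im, div_eq_div_iff (log_natCast_pos hp).ne' (log_natCast_pos hq).ne',
    mul_assoc, mul_assoc (2 * Real.pi)] at h1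
  exact eq_of_int_mul_log_eq hp hq hν (mul_left_cancel₀ (by positivity) h1)

lemma logPole_ne_zero {b : ℕ} (hb : b.Prime) {ν : ℤ} (hν : ν ≠ 0) : logPole b ν ≠ 0 := by
  intro h
  apply hν
  apply logPole_injective hb
  rw [h]
  simp [logPole]

lemma differentiable_one_sub_one_div_cpow {b : ℕ} (hb : b ≠ 0) :
    Differentiable ℂ fun s : ℂ => 1 - 1 / (b : ℂ) ^ s := by
  have : (fun s : ℂ => 1 - 1 / (b : ℂ) ^ s) = fun s => 1 - Complex.exp (-(Real.log b * s)) := by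
    funext s
    rw [natCast_cpow_eq_exp hb, one_div, ← Complex.exp_neg]
  rw [this]
  fun_prop

lemma deriv_one_sub_one_div_cpow {b : ℕ} (hb : b.Prime) (ν : ℤ) :
    deriv (fun s : ℂ => 1 - 1 / (b : ℂ) ^ s) (logPole b ν) = Real.log b := by
  have h1 : (fun s : ℂ => 1 - 1 / (b : ℂ) ^ s) = fun s => 1 - Complex.exp (-(Real.log b * s)) := by
    funext s
    rw [natCast_cpow_eq_exp hb.ne_zero, one_div, ← Complex.exp_neg]
  have h2 : Complex.exp (-(Real.log b * logPole b ν)) = 1 := by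
    have := congrFun h1 (logPole b ν)
    rw [(one_sub_one_div_cpow_eq_zero_iff hb).2 ⟨ν, rfl⟩] at this
    linear_combination this
  have h3 : HasDerivAt (fun s : ℂ => -((Real.log b : ℂ) * s)) (-(Real.log b : ℂ)) (logPole b ν) := by
    simpa only [id, mul_one] using
      ((hasDerivAt_id (logPole b ν)).const_mul (Real.log b : ℂ)).fun_neg
  have h4 := (h3.cexp.const_sub 1).deriv
  rw [h1, h4, h2]
  simp

section poles

variable {n : ℕ} {a : Fin n → ℕ} {x : ℝ}

lemma analyticAt_ofReal_cpow (hx : 0 < x) (p : ℂ) : AnalyticAt ℂ (fun s : ℂ => (x : ℂ) ^ s) p :=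
  Complex.analyticAt_iff_eventually_differentiableAt.2 (Eventually.of_forall fun _ =>
    differentiableAt_id.const_cpow (Or.inl (Complex.ofReal_ne_zero.2 hx.ne')))

lemma analyticAt_one_sub_one_div_cpow {b : ℕ} (hb : b ≠ 0) (p : ℂ) :
    AnalyticAt ℂ (fun s : ℂ => 1 - 1 / (b : ℂ) ^ s) p :=
  Complex.analyticAt_iff_eventually_differentiableAt.2 (Eventually.of_forall fun s =>
    differentiable_one_sub_one_div_cpow hb s)

lemma analyticAt_prod_one_sub (ha : ∀ k, a k ≠ 0) (S : Finset (Fin n)) (p : ℂ) :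
    AnalyticAt ℂ (fun s : ℂ => ∏ k ∈ S, (1 - 1 / (a k : ℂ) ^ s)) p :=
  Finset.analyticAt_fun_prod S fun k _ => analyticAt_one_sub_one_div_cpow (ha k) p

lemma meromorphicAt_perronIntegrand (ha : ∀ k, a k ≠ 0) (hx : 0 < x) (p : ℂ) :
    MeromorphicAt (perronIntegrand a x) p :=
  (analyticAt_ofReal_cpow hx p).meromorphicAt.div
    ((analyticAt_id.mul (analyticAt_prod_one_sub ha Finset.univ p)).meromorphicAt)

lemma differentiableAt_perronIntegrand (ha : ∀ k, (a k).Prime) (hx : 0 < x) {s : ℂ}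
    (hs0 : s ≠ 0) (hs : ∀ k, ∀ ν : ℤ, s ≠ logPole (a k) ν) :
    DifferentiableAt ℂ (perronIntegrand a x) s := by
  refine (analyticAt_ofReal_cpow hx s).differentiableAt.div (differentiableAt_id.mul
    (analyticAt_prod_one_sub (fun k => (ha k).ne_zero) Finset.univ s).differentiableAt) ?_
  refine mul_ne_zero hs0 (Finset.prod_ne_zero_iff.2 fun k _ h => ?_)
  obtain ⟨ν, hν⟩ := (one_sub_one_div_cpow_eq_zero_iff (ha k)).1 h
  exact hs k ν hν

lemma one_sub_one_div_cpow_logPole_ne_zero (ha : ∀ k, (a k).Prime) (hinj : Function.Injective a)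
    {m l : Fin n} (hl : l ≠ m) {ν : ℤ} (hν : ν ≠ 0) :
    1 - 1 / (a l : ℂ) ^ logPole (a m) ν ≠ 0 := by
  intro h
  obtain ⟨μ, hμ⟩ := (one_sub_one_div_cpow_eq_zero_iff (ha l)).1 h
  exact hl (hinj (eq_of_logPole_eq (ha m) (ha l) hν hμ))

/-- Only the factor of `a m` vanishes at this point, and it does so simply: it is `(s - p)` times
its `dslope`, whose value at `p` is the derivative `log (a m)`. -/
lemma residue_perronIntegrand (ha : ∀ k, (a k).Prime) (hinj : Function.Injective a) (hx : 0 < x)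
    (m : Fin n) {ν : ℤ} (hν : ν ≠ 0) :
    residue (perronIntegrand a x) (logPole (a m) ν) =
      (x : ℂ) ^ logPole (a m) ν / (logPole (a m) ν * (Real.log (a m) *
        ∏ l ∈ Finset.univ.erase m, (1 - 1 / (a l : ℂ) ^ logPole (a m) ν))) := by
  set p := logPole (a m) ν with hp
  set f : ℂ → ℂ := fun s => 1 - 1 / (a m : ℂ) ^ s with hf
  have hfp : f p = 0 := (one_sub_one_div_cpow_eq_zero_iff (ha m)).2 ⟨ν, rfl⟩
  have hd : AnalyticAt ℂ (dslope f p) p := by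
    obtain ⟨q, hq⟩ := analyticAt_one_sub_one_div_cpow (ha m).ne_zero p
    exact hq.has_fpower_series_dslope_fslope.analyticAt
  have hdp : dslope f p p = Real.log (a m) := by
    rw [dslope_same]
    exact deriv_one_sub_one_div_cpow (ha m) ν
  have hg : AnalyticAt ℂ (fun s => (x : ℂ) ^ s / (s * (dslope f p s *
      ∏ l ∈ Finset.univ.erase m, (1 - 1 / (a l : ℂ) ^ s)))) p := by
    refine (analyticAt_ofReal_cpow hx p).div (analyticAt_id.mul (hd.mul
      (analyticAt_prod_one_sub (fun k => (ha k).ne_zero) _ p))) ?_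
    refine mul_ne_zero (logPole_ne_zero (ha m) hν) (mul_ne_zero ?_
      (Finset.prod_ne_zero_iff.2 fun l hl => ?_))
    · rw [hdp]
      exact Complex.ofReal_ne_zero.2 (log_natCast_pos (ha m)).ne'
    · exact one_sub_one_div_cpow_logPole_ne_zero ha hinj (Finset.ne_of_mem_erase hl) hν
  rw [residue_eq_of_simple_pole hg, hdp]
  intro s hs
  have h1 : f s = (s - p) * dslope f p s := by
    have := sub_smul_dslope f p s
    rw [smul_eq_mul] at this
    rw [this, hfp, sub_zero]
  unfold perronIntegrand
  rw [← Finset.mul_prod_erase Finset.univ _ (Finset.mem_univ m)]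
  change (x : ℂ) ^ s / (s * (f s * _)) = _
  rw [h1, ← div_eq_inv_mul, div_div]
  congr 1
  ring

end poles

/-! ### The sum of the residues -/

/-- Because `1 - e^{-2iθ} = 2 sin θ (sin θ + i cos θ)`; the hypothesis forces `sin θ ≠ 0`. -/
lemma inv_one_sub_exp {θ : ℝ} (h : 1 - Complex.exp (-(2 * θ * Complex.I)) ≠ 0) :
    (1 - Complex.exp (-(2 * θ * Complex.I)))⁻¹ = (1 + -Complex.I * (Real.cot θ : ℂ)) / 2 := by
  have h1 : Complex.exp (-(2 * θ * Complex.I)) =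
      ((Real.cos θ : ℂ) - Real.sin θ * Complex.I) ^ 2 := by
    have : (Real.cos θ : ℂ) - Real.sin θ * Complex.I = Complex.exp (-(θ : ℂ) * Complex.I) := by
      rw [Complex.exp_mul_I, Complex.cos_neg, Complex.sin_neg, Complex.ofReal_cos,
        Complex.ofReal_sin]
      ring
    rw [this, ← Complex.exp_nat_mul]
    congr 1
    push_cast
    ring
  have h2 : (Real.sin θ : ℂ) ^ 2 + (Real.cos θ : ℂ) ^ 2 = 1 := by
    exact_mod_cast Real.sin_sq_add_cos_sq θ
  have hI := Complex.I_sq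
  have h3 : 1 - Complex.exp (-(2 * θ * Complex.I)) =
      2 * Real.sin θ * (Real.sin θ + Real.cos θ * Complex.I) := by
    rw [h1]
    linear_combination (-1 : ℂ) * h2 - (Real.sin θ : ℂ) ^ 2 * hI
  have h4 : (Real.sin θ : ℂ) ≠ 0 := by
    intro h0
    rw [h3, h0] at h
    simp at h
  refine inv_eq_of_mul_eq_one_right ?_
  rw [h3, Real.cot_eq_cos_div_sin, Complex.ofReal_div]
  generalize (Real.sin θ : ℂ) = s at *
  generalize (Real.cos θ : ℂ) = c at *
  field_simp
  linear_combination h2 - c ^ 2 * hI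

lemma sum_Icc_neg_erase_zero (K : ℕ) (f : ℤ → ℂ) :
    ∑ ν ∈ (Finset.Icc (-(K : ℤ)) K).erase 0, f ν =
      ∑ k ∈ Finset.Icc 1 K, (f k + f (-(k : ℤ))) := by
  induction K with
  | zero => simp
  | succ K ih =>
    have h : (Finset.Icc (-((K + 1 : ℕ) : ℤ)) (K + 1 : ℕ)).erase 0 =
        insert ((K : ℤ) + 1) (insert (-((K : ℤ) + 1)) ((Finset.Icc (-(K : ℤ)) K).erase 0)) := by
      ext ν
      simp only [Finset.mem_erase, Finset.mem_Icc, Finset.mem_insert]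
      push_cast
      omega
    rw [h, Finset.sum_insert, Finset.sum_insert, ih, Finset.sum_Icc_succ_top (by omega)]
    · push_cast
      ring
    · simp
    · simp only [Finset.mem_erase, Finset.mem_Icc, Finset.mem_insert]
      omega

section residues

variable {n : ℕ} {a : Fin n → ℕ} {x : ℝ}

/-- The part of the residue at `2πiν / log a_m` that belongs to the index set `S`. -/
noncomputable def residueTerm (a : Fin n → ℕ) (x : ℝ) (m : Fin n) (S : Finset (Fin n)) (ν : ℤ) :
    ℂ :=
  Complex.exp (2 * Real.pi * ν * (Real.log x / Real.log (a m)) * Complex.I) *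
    (-Complex.I) ^ S.card / (2 * Real.pi * ν * Complex.I) *
      ∏ l ∈ S, (Real.cot (Real.pi * ν * Real.log (a l) / Real.log (a m)) : ℂ)

/-- Each of the `n - 1` other factors becomes `(1 - i cot) / 2`, and multiplying out gives one term
per subset. The factor `log (a m)` cancels the denominator of the pole. -/
lemma residue_perronIntegrand_eq_sum (ha : ∀ k, (a k).Prime) (hinj : Function.Injective a)
    (hx : 0 < x) (m : Fin n) {ν : ℤ} (hν : ν ≠ 0) :
    residue (perronIntegrand a x) (logPole (a m) ν) =
      1 / 2 ^ (n - 1) * ∑ S ∈ (Finset.univ.erase m).powerset, residueTerm a x m S ν := by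
  have hm : (Real.log (a m) : ℂ) ≠ 0 := Complex.ofReal_ne_zero.2 (log_natCast_pos (ha m)).ne'
  have hxp : (x : ℂ) ^ logPole (a m) ν =
      Complex.exp (2 * Real.pi * ν * (Real.log x / Real.log (a m)) * Complex.I) := by
    rw [Complex.cpow_def_of_ne_zero (Complex.ofReal_ne_zero.2 hx.ne'), ← Complex.ofReal_log hx.le,
      logPole]
    congr 1
    rw [Complex.ofReal_div]
    push_cast
    ring
  have hfac : ∀ l ∈ Finset.univ.erase m, (1 - 1 / (a l : ℂ) ^ logPole (a m) ν)⁻¹ =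
      (1 + -Complex.I * (Real.cot (Real.pi * ν * Real.log (a l) / Real.log (a m)) : ℂ)) / 2 := by
    intro l hl
    have h1 := one_sub_one_div_cpow_logPole_ne_zero ha hinj (Finset.ne_of_mem_erase hl) hν
    have h2 : 1 / (a l : ℂ) ^ logPole (a m) ν = Complex.exp (-(2 *
        ((Real.pi * ν * Real.log (a l) / Real.log (a m) : ℝ) : ℂ) * Complex.I)) := by
      rw [natCast_cpow_eq_exp (ha l).ne_zero, one_div, ← Complex.exp_neg, logPole]
      congr 1
      rw [Complex.ofReal_div, Complex.ofReal_div]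
      push_cast
      ring
    rw [h2] at h1 ⊢
    exact inv_one_sub_exp h1
  have hden : logPole (a m) ν * Real.log (a m) = 2 * Real.pi * ν * Complex.I := by
    rw [logPole, Complex.ofReal_div]
    generalize (Real.log (a m) : ℂ) = c at hm
    push_cast
    field_simp
  have hprod : (∏ l ∈ Finset.univ.erase m, (1 - 1 / (a l : ℂ) ^ logPole (a m) ν))⁻¹ =
      1 / 2 ^ (n - 1) * ∑ S ∈ (Finset.univ.erase m).powerset, (-Complex.I) ^ S.card *
        ∏ l ∈ S, (Real.cot (Real.pi * ν * Real.log (a l) / Real.log (a m)) : ℂ) := by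
    rw [← Finset.prod_inv_distrib, Finset.prod_congr rfl hfac, Finset.prod_div_distrib,
      Finset.prod_const, Finset.card_erase_of_mem (Finset.mem_univ m), Finset.card_univ,
      Fintype.card_fin, Finset.prod_one_add, div_eq_inv_mul, one_div]
    congr 1
    refine Finset.sum_congr rfl fun S _ => ?_
    rw [Finset.prod_mul_distrib, Finset.prod_const]
  rw [residue_perronIntegrand ha hinj hx m hν, ← mul_assoc, hden, hxp, div_mul_eq_div_div,
    div_eq_mul_inv _ (∏ l ∈ Finset.univ.erase m, (1 - 1 / (a l : ℂ) ^ logPole (a m) ν)), hprod,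
    mul_left_comm, Finset.mul_sum]
  congr 1
  refine Finset.sum_congr rfl fun S _ => ?_
  unfold residueTerm
  ring

/-- The two terms are complex conjugates: the cotangent is odd, which supplies `(-1)^|S|`, and
`(-i)^|S| = e^{-iπ|S|/2}` is the phase shift in the sine. -/
lemma residueTerm_add_neg (m : Fin n) (S : Finset (Fin n)) (k : ℕ) :
    residueTerm a x m S k + residueTerm a x m S (-(k : ℤ)) =
      ((cotangentTerm a x m S k / Real.pi : ℝ) : ℂ) := by
  unfold residueTerm cotangentTerm
  have hpi : (Real.pi : ℂ) ≠ 0 := Complex.ofReal_ne_zero.2 Real.pi_ne_zero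
  set φ : ℝ := 2 * Real.pi * k * (Real.log x / Real.log (a m)) with hφ
  have e1 : (2 * Real.pi * ((k : ℤ) : ℂ) * (Real.log x / Real.log (a m)) * Complex.I : ℂ) =
      φ * Complex.I := by
    rw [hφ]; push_cast; ring
  have e2 : (2 * Real.pi * ((-(k : ℤ) : ℤ) : ℂ) * (Real.log x / Real.log (a m)) * Complex.I : ℂ) =
      -(φ : ℂ) * Complex.I := by
    rw [hφ]; push_cast; ring
  have e3 : ∏ l ∈ S, (Real.cot (Real.pi * ((-(k : ℤ) : ℤ) : ℝ) * Real.log (a l) /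
      Real.log (a m)) : ℂ) = (-1) ^ S.card *
      ∏ l ∈ S, (Real.cot (Real.pi * k * Real.log (a l) / Real.log (a m)) : ℂ) := by
    rw [← Finset.prod_const, ← Finset.prod_mul_distrib]
    refine Finset.prod_congr rfl fun l _ => ?_
    have : Real.pi * ((-(k : ℤ) : ℤ) : ℝ) * Real.log (a l) / Real.log (a m) =
        -(Real.pi * k * Real.log (a l) / Real.log (a m)) := by push_cast; ring
    rw [this, Real.cot_eq_cos_div_sin, Real.cot_eq_cos_div_sin, Real.cos_neg, Real.sin_neg]
    push_cast
    ring
  have e4 : (-Complex.I) ^ S.card = Complex.exp (-(((Real.pi * S.card / 2 : ℝ) : ℂ) * Complex.I)) := by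
    have : -Complex.I = Complex.exp (-(Real.pi / 2 * Complex.I)) := by
      rw [Complex.exp_neg, Complex.exp_pi_div_two_mul_I, Complex.inv_I]
    rw [this, ← Complex.exp_nat_mul]
    congr 1
    push_cast
    ring
  have e5 : (-Complex.I) ^ S.card * (-1) ^ S.card =
      Complex.exp (((Real.pi * S.card / 2 : ℝ) : ℂ) * Complex.I) := by
    have : -Complex.I * -1 = Complex.exp (Real.pi / 2 * Complex.I) := by
      rw [Complex.exp_pi_div_two_mul_I]; ring
    rw [← mul_pow, this, ← Complex.exp_nat_mul]
    congr 1
    push_cast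
    ring
  set c : ℂ := ∏ l ∈ S, (Real.cot (Real.pi * k * Real.log (a l) / Real.log (a m)) : ℂ) with hc
  have e6 : Complex.exp (φ * Complex.I) * (-Complex.I) ^ S.card -
      Complex.exp (-(φ : ℂ) * Complex.I) * ((-Complex.I) ^ S.card * (-1) ^ S.card) =
      2 * Complex.I * Real.sin (φ - Real.pi * S.card / 2) := by
    rw [e5, e4, ← Complex.exp_add, ← Complex.exp_add, Complex.ofReal_sin]
    set ψ : ℝ := φ - Real.pi * S.card / 2 with hψ
    have i1 : φ * Complex.I + -(((Real.pi * S.card / 2 : ℝ) : ℂ) * Complex.I) =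
        ψ * Complex.I := by rw [hψ]; push_cast; ring
    have i2 : -(φ : ℂ) * Complex.I + ((Real.pi * S.card / 2 : ℝ) : ℂ) * Complex.I =
        -ψ * Complex.I := by rw [hψ]; push_cast; ring
    have i3 := Complex.two_sin (ψ : ℂ)
    rw [i1, i2]
    linear_combination (-Complex.I) * i3 +
      (Complex.exp (ψ * Complex.I) - Complex.exp (-ψ * Complex.I)) * Complex.I_sq
  rw [e1, e2, e3]
  have hcast : ((Real.sin (φ - Real.pi * S.card / 2) / k *
      (∏ l ∈ S, Real.cot (Real.pi * k * Real.log (a l) / Real.log (a m))) / Real.pi : ℝ) : ℂ) =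
      Real.sin (φ - Real.pi * S.card / 2) / k * c / Real.pi := by
    rw [hc, Complex.ofReal_div, Complex.ofReal_mul, Complex.ofReal_div, Complex.ofReal_prod,
      Complex.ofReal_natCast]
  rw [hcast]
  simp only [Int.cast_natCast, Int.cast_neg]
  rw [← hc]
  -- For `k = 0` both sides vanish by the convention on division by zero.
  rcases Nat.eq_zero_or_pos k with rfl | hk
  · simp
  have hk0 : (k : ℂ) ≠ 0 := Nat.cast_ne_zero.2 hk.ne'
  have hI := Complex.I_ne_zero
  have e7 : Complex.exp (φ * Complex.I) * (-Complex.I) ^ S.card / (2 * Real.pi * k * Complex.I) * c +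
      Complex.exp (-(φ : ℂ) * Complex.I) * (-Complex.I) ^ S.card /
        (2 * Real.pi * -(k : ℂ) * Complex.I) * ((-1) ^ S.card * c) =
      (Complex.exp (φ * Complex.I) * (-Complex.I) ^ S.card -
      Complex.exp (-(φ : ℂ) * Complex.I) * ((-Complex.I) ^ S.card * (-1) ^ S.card)) *
        c / (2 * Real.pi * k * Complex.I) := by
    field_simp
    ring
  rw [e7, e6]
  field_simp

/-- The sum of all the terms with `k ≤ R log a_m`, the empty index set included. -/
noncomputable def fullSum (a : Fin n → ℕ) (x R : ℝ) : ℝ :=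
  ∑ m : Fin n, ∑ k ∈ Finset.Icc 1 ⌊R * Real.log (a m)⌋₊,
    ∑ S ∈ (Finset.univ.erase m).powerset, cotangentTerm a x m S k

lemma sum_residue_perronIntegrand (ha : ∀ k, (a k).Prime) (hinj : Function.Injective a)
    (hx : 0 < x) (m : Fin n) (K : ℕ) :
    ∑ ν ∈ (Finset.Icc (-(K : ℤ)) K).erase 0,
        residue (perronIntegrand a x) (logPole (a m) ν) =
      ((1 / (2 ^ (n - 1) * Real.pi) * ∑ k ∈ Finset.Icc 1 K,
        ∑ S ∈ (Finset.univ.erase m).powerset, cotangentTerm a x m S k : ℝ) : ℂ) := by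
  rw [sum_Icc_neg_erase_zero, Complex.ofReal_mul, Complex.ofReal_sum, Finset.mul_sum]
  refine Finset.sum_congr rfl fun k hk => ?_
  have hk0 : (k : ℤ) ≠ 0 := by
    have := (Finset.mem_Icc.1 hk).1
    omega
  rw [residue_perronIntegrand_eq_sum ha hinj hx m hk0,
    residue_perronIntegrand_eq_sum ha hinj hx m (neg_ne_zero.2 hk0), ← mul_add,
    ← Finset.sum_add_distrib, Complex.ofReal_sum, Finset.mul_sum, Finset.mul_sum]
  refine Finset.sum_congr rfl fun S _ => ?_
  rw [residueTerm_add_neg]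
  push_cast
  rw [one_div, one_div, mul_inv]
  ring

lemma rectIntegral_perronIntegrand (ha : ∀ k, (a k).Prime) (hinj : Function.Injective a)
    (hx : 0 < x) {R : ℝ} (hR : 0 < R) (hcut : ∀ k, ∀ ν : ℤ, R * Real.log (a k) ≠ ν) :
    rectIntegral (perronIntegrand a x) ⟨-1, -(2 * Real.pi * R)⟩ ⟨1, 2 * Real.pi * R⟩ =
      2 * Real.pi * Complex.I * (residue (perronIntegrand a x) 0 +
        ((1 / (2 ^ (n - 1) * Real.pi) * fullSum a x R : ℝ) : ℂ)) := by
  classical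
  have hT : 0 < 2 * Real.pi * R := by positivity
  set K : Fin n → ℕ := fun m => ⌊R * Real.log (a m)⌋₊ with hK
  set I : Fin n → Finset ℤ := fun m => (Finset.Icc (-(K m : ℤ)) (K m)).erase 0 with hI
  have hRl : ∀ m, 0 ≤ R * Real.log (a m) := fun m =>
    mul_nonneg hR.le (log_natCast_pos (ha m)).le
  -- The poles other than `0`. The index `0` is left out for every prime, since the pole at `0` is
  -- common to all of them and is inserted once, with its residue unevaluated.
  set Q : Finset ℂ := Finset.univ.biUnion fun m => (I m).image (logPole (a m)) with hQ
  have hQmem : ∀ p, p ∈ Q ↔ ∃ m, ∃ ν ∈ I m, logPole (a m) ν = p := by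
    intro p
    simp [hQ]
  have h0Q : (0 : ℂ) ∉ Q := by
    rw [hQmem]
    rintro ⟨m, ν, hν, h⟩
    exact logPole_ne_zero (ha m) (Finset.ne_of_mem_erase hν) h
  have hres := rectIntegral_eq_sum_residue (f := perronIntegrand a x)
    (z := ⟨-1, -(2 * Real.pi * R)⟩) (w := ⟨1, 2 * Real.pi * R⟩)
    (by simp) (by simp only; linarith) (insert 0 Q) ?_ ?_
    (fun p _ => meromorphicAt_perronIntegrand (fun k => (ha k).ne_zero) hx p)
  · rw [hres, Finset.sum_insert h0Q, hQ, Finset.sum_biUnion]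
    · congr 2
      rw [fullSum, Finset.mul_sum, Complex.ofReal_sum]
      refine Finset.sum_congr rfl fun m _ => ?_
      rw [Finset.sum_image ((logPole_injective (ha m)).injOn)]
      exact sum_residue_perronIntegrand ha hinj hx m (K m)
    · intro m _ m' _ hmm'
      rw [Function.onFun, Finset.disjoint_left]
      intro p hp hp'
      obtain ⟨ν, hν, rfl⟩ := Finset.mem_image.1 hp
      obtain ⟨μ, _, hμ⟩ := Finset.mem_image.1 hp'
      exact hmm' (hinj (eq_of_logPole_eq (ha m) (ha m') (Finset.ne_of_mem_erase hν) hμ.symm)).symm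
  · intro p hp
    rcases Finset.mem_insert.1 hp with rfl | hp
    · exact ⟨by simp, by simpa using hT⟩
    · obtain ⟨m, ν, hν, rfl⟩ := (hQmem p).1 hp
      have hl := log_natCast_pos (ha m)
      have hν' := Finset.mem_Icc.1 (Finset.mem_of_mem_erase hν)
      have hfl : (K m : ℝ) ≤ R * Real.log (a m) := Nat.floor_le (hRl m)
      have h1 : (ν : ℝ) ≤ K m := by exact_mod_cast hν'.2
      have h2 : -(K m : ℝ) ≤ ν := by exact_mod_cast hν'.1
      have h3 : (ν : ℝ) < R * Real.log (a m) := lt_of_le_of_ne (h1.trans hfl) (hcut m ν).symm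
      have h4 : -(R * Real.log (a m)) < ν := by
        refine lt_of_le_of_ne (by linarith) fun h => hcut m (-ν) ?_
        push_cast
        linarith
      refine ⟨?_, ?_⟩
      · rw [Set.mem_preimage, logPole_re]
        simp
      · rw [Set.mem_preimage, logPole_im, Set.mem_Ioo, lt_div_iff₀ hl, div_lt_iff₀ hl]
        have := Real.pi_pos
        constructor <;> nlinarith
  · intro s hs hsP
    refine differentiableAt_perronIntegrand ha hx
      (fun h => hsP (h ▸ Finset.mem_insert_self _ _)) fun m ν hsν => hsP ?_
    have hl := log_natCast_pos (ha m)
    have him := hs.2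
    rw [Set.mem_preimage, hsν, logPole_im, Set.mem_Icc, le_div_iff₀ hl, div_le_iff₀ hl] at him
    have hpi := Real.pi_pos
    have h1 : (ν : ℝ) ≤ R * Real.log (a m) := by
      have := him.2
      simp only at this
      nlinarith
    have h2 : -(ν : ℝ) ≤ R * Real.log (a m) := by
      have := him.1
      simp only at this
      nlinarith
    by_cases hν : ν = 0
    · rw [hsν, hν]
      simp [logPole]
    · refine Finset.mem_insert_of_mem ((hQmem s).2 ⟨m, ν, ?_, hsν.symm⟩)
      refine Finset.mem_erase.2 ⟨hν, Finset.mem_Icc.2 ?_⟩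
      have h3 : ν.natAbs ≤ K m := by
        refine Nat.le_floor ?_
        rw [Nat.cast_natAbs, Int.cast_abs]
        exact abs_le'.2 ⟨h1, h2⟩
      omega

/-- Grouping the subsets by cardinality `0, …, n - 1`, the empty one gives the pure sine series and
the rest is the cotangent sum. -/
lemma fullSum_eq (R : ℝ) :
    fullSum a x R = ∑ m : Fin n, ∑ k ∈ Finset.Icc 1 ⌊R * Real.log (a m)⌋₊,
      Real.sin (2 * Real.pi * k * (Real.log x / Real.log (a m))) / k + cotangentSum a x R := by
  unfold fullSum cotangentSum
  rw [← Finset.sum_add_distrib]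
  refine Finset.sum_congr rfl fun m _ => ?_
  have hn : 1 ≤ n := Nat.one_le_iff_ne_zero.2 fun h => (h ▸ m).elim0
  rw [Finset.sum_comm, Finset.sum_powerset, Finset.card_erase_of_mem (Finset.mem_univ m),
    Finset.card_univ, Fintype.card_fin, Finset.range_eq_Ico, Finset.sum_eq_sum_Ico_succ_bot
    (by omega)]
  congr 1
  simp [cotangentTerm]

end residues

/-! ### The Fourier series of the sawtooth function -/

/-- Dirichlet's test gives convergence on the unit circle off `1`, since the geometric partial sums
are bounded; Abel's limit theorem then identifies the value from inside the disc. -/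
lemma tendsto_sum_pow_div {z : ℂ} (hz : ‖z‖ = 1) (hz1 : z ≠ 1) :
    Tendsto (fun K : ℕ => ∑ k ∈ Finset.range K, z ^ k / k) atTop (𝓝 (-Complex.log (1 - z))) := by
  have hanti : Antitone fun i : ℕ => 1 / ((i : ℝ) + 1) := fun i j hij =>
    one_div_le_one_div_of_le (by positivity) (by exact_mod_cast Nat.succ_le_succ hij)
  have hbound : ∀ K, ‖∑ i ∈ Finset.range K, z ^ (i + 1)‖ ≤ 2 / ‖z - 1‖ := by
    intro K
    have h1 : ∑ i ∈ Finset.range K, z ^ (i + 1) = z * ((z ^ K - 1) / (z - 1)) := by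
      rw [← geom_sum_eq hz1, Finset.mul_sum]
      exact Finset.sum_congr rfl fun i _ => pow_succ' z i
    rw [h1, norm_mul, hz, one_mul, norm_div]
    refine div_le_div_of_nonneg_right ((norm_sub_le _ _).trans ?_) (norm_nonneg _)
    rw [norm_pow, hz, one_pow, norm_one]
    norm_num
  obtain ⟨l, hl⟩ := cauchySeq_tendsto_of_complete
    (hanti.cauchySeq_series_mul_of_tendsto_zero_of_bounded
      tendsto_one_div_add_atTop_nhds_zero_nat hbound)
  have hl' : Tendsto (fun K : ℕ => ∑ k ∈ Finset.range K, z ^ k / k) atTop (𝓝 l) := by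
    refine (tendsto_add_atTop_iff_nat 1).1 (hl.congr fun K => ?_)
    rw [Finset.sum_range_succ']
    simp only [Nat.cast_zero, div_zero, add_zero]
    refine Finset.sum_congr rfl fun i _ => ?_
    rw [Complex.real_smul]
    push_cast
    ring
  have habel := Complex.tendsto_tsum_powerSeries_nhdsWithin_lt hl'
  rw [tendsto_map'_iff] at habel
  have hre : 0 < (1 - z).re := by
    have h1 : z.re ≤ 1 := (Complex.re_le_norm z).trans hz.le
    have h2 : z.re ≠ 1 := by
      intro h
      apply hz1
      have h3 := Complex.sq_norm z
      rw [hz, Complex.normSq_apply, h] at h3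
      have h4 : z.im = 0 := by nlinarith
      exact Complex.ext h h4
    simpa using lt_of_le_of_ne h1 h2
  have hlog : Tendsto (fun r : ℝ => -Complex.log (1 - z * r)) (𝓝[<] 1)
      (𝓝 (-Complex.log (1 - z))) := by
    have hc : ContinuousAt (fun r : ℝ => -Complex.log (1 - z * r)) 1 := by
      refine (ContinuousAt.clog (by fun_prop) ?_).neg
      rw [Complex.ofReal_one, mul_one]
      exact Or.inl hre
    have := hc.tendsto
    simp only [Complex.ofReal_one, mul_one] at this
    exact this.mono_left nhdsWithin_le_nhds
  have heq : l = -Complex.log (1 - z) := by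
    refine tendsto_nhds_unique habel (hlog.congr' ?_)
    filter_upwards [Ioo_mem_nhdsLT (show (0 : ℝ) < 1 by norm_num)] with r hr
    have hn : ‖z * r‖ < 1 := by
      rw [norm_mul, hz, one_mul, Complex.norm_real, Real.norm_of_nonneg hr.1.le]
      exact hr.2
    rw [← (Complex.hasSum_taylorSeries_neg_log hn).tsum_eq]
    refine tsum_congr fun k => ?_
    rw [mul_pow]
    ring
  rw [← heq]
  exact hl'

/-- Polar form: `1 - e^{2iα} = 2 sin α · e^{i(α - π/2)}` with `α = πf` and `sin α > 0`. -/
lemma arg_one_sub_exp {f : ℝ} (h0 : 0 < f) (h1 : f < 1) :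
    Complex.arg (1 - Complex.exp ((2 * Real.pi * f : ℝ) * Complex.I)) = Real.pi * (f - 1 / 2) := by
  have hpi := Real.pi_pos
  have hs : 0 < 2 * Real.sin (Real.pi * f) :=
    mul_pos two_pos (Real.sin_pos_of_pos_of_lt_pi (by positivity) (by nlinarith))
  have e : 1 - Complex.exp ((2 * Real.pi * f : ℝ) * Complex.I) =
      ((2 * Real.sin (Real.pi * f) : ℝ) : ℂ) *
        (Complex.cos ((Real.pi * (f - 1 / 2) : ℝ) : ℂ) +
          Complex.sin ((Real.pi * (f - 1 / 2) : ℝ) : ℂ) * Complex.I) := by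
    have i1 : Real.pi * (f - 1 / 2) = Real.pi * f - Real.pi / 2 := by ring
    have i2 : 2 * Real.pi * f = 2 * (Real.pi * f) := by ring
    rw [← Complex.ofReal_cos, ← Complex.ofReal_sin, i1, Real.cos_sub_pi_div_two,
      Real.sin_sub_pi_div_two, Complex.exp_mul_I, ← Complex.ofReal_cos, ← Complex.ofReal_sin, i2,
      Real.cos_two_mul, Real.sin_two_mul]
    have h : (Real.sin (Real.pi * f) : ℂ) ^ 2 + (Real.cos (Real.pi * f) : ℂ) ^ 2 = 1 := by
      exact_mod_cast Real.sin_sq_add_cos_sq (Real.pi * f)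
    generalize Real.sin (Real.pi * f) = s at h ⊢
    generalize Real.cos (Real.pi * f) = c at h ⊢
    push_cast
    linear_combination (-2 : ℂ) * h
  rw [e, Complex.arg_mul_cos_add_sin_mul_I hs]
  constructor <;> nlinarith

/-- The imaginary part of the logarithmic series at `e^{2πi{y}}`; for integral `y` every term is
zero, matching the value `0` of `bernoulliStar`. -/
lemma tendsto_sum_sin_div (y : ℝ) :
    Tendsto (fun K : ℕ => ∑ k ∈ Finset.Icc 1 K, Real.sin (2 * Real.pi * k * y) / k) atTop
      (𝓝 (-(Real.pi * bernoulliStar y))) := by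
  unfold bernoulliStar
  split_ifs with hy
  · obtain ⟨m, rfl⟩ := hy
    have : ∀ K : ℕ, ∑ k ∈ Finset.Icc 1 K, Real.sin (2 * Real.pi * k * (m : ℝ)) / k = 0 := by
      intro K
      refine Finset.sum_eq_zero fun k _ => ?_
      have h : 2 * Real.pi * k * (m : ℝ) = ((2 * k * m : ℤ) : ℝ) * Real.pi := by push_cast; ring
      rw [h, Real.sin_int_mul_pi, zero_div]
    simp [this]
  · set f := Int.fract y with hf
    have hf0 : 0 < f := by
      refine lt_of_le_of_ne (Int.fract_nonneg y) fun h => hy ⟨⌊y⌋, ?_⟩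
      have := Int.floor_add_fract y
      rw [← hf, ← h] at this
      linarith
    have hf1 : f < 1 := Int.fract_lt_one y
    set z := Complex.exp ((2 * Real.pi * f : ℝ) * Complex.I) with hz
    have hz1 : z ≠ 1 := by
      intro h
      rw [hz, Complex.exp_eq_one_iff] at h
      obtain ⟨m, hm⟩ := h
      have h1 := congrArg Complex.im hm
      rw [Complex.im_ofReal_mul, Complex.I_im] at h1
      have h2 : (m : ℂ) * (2 * Real.pi * Complex.I) =
          ((m * (2 * Real.pi) : ℝ) : ℂ) * Complex.I := by push_cast; ring
      rw [h2, Complex.im_ofReal_mul, Complex.I_im, mul_one, mul_one, mul_comm] at h1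
      have h3 : f = m := mul_right_cancel₀ (by positivity : (2 * Real.pi : ℝ) ≠ 0) h1
      rw [h3] at hf0 hf1
      have h4 : 0 < m := by exact_mod_cast hf0
      have h5 : m < 1 := by exact_mod_cast hf1
      omega
    have hlim := tendsto_sum_pow_div (Complex.norm_exp_ofReal_mul_I _) hz1
    have him := (Complex.continuous_im.tendsto _).comp ((tendsto_add_atTop_iff_nat 1).2 hlim)
    have hval : (-Complex.log (1 - z)).im = -(Real.pi * (f - 1 / 2)) := by
      rw [Complex.neg_im, Complex.log_im, arg_one_sub_exp hf0 hf1]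
    rw [hval] at him
    refine him.congr fun K => ?_
    rw [Function.comp_apply, Finset.range_eq_Ico, Finset.sum_eq_sum_Ico_succ_bot (by omega),
      Complex.add_im, Complex.im_sum]
    simp only [Nat.cast_zero, div_zero, Complex.zero_im, zero_add]
    refine Finset.sum_congr rfl fun k _ => ?_
    have h1 : z ^ k = Complex.exp ((k * (2 * Real.pi * f) : ℝ) * Complex.I) := by
      rw [hz, ← Complex.exp_nat_mul]
      congr 1
      push_cast
      ring
    have h2 : 2 * Real.pi * k * y = k * (2 * Real.pi * f) + ((k * ⌊y⌋ : ℤ) : ℝ) * (2 * Real.pi) := by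
      have := Int.floor_add_fract y
      push_cast
      rw [hf]
      linear_combination (-2 * Real.pi * k) * this
    rw [h1, h2, Real.sin_add_int_mul_two_pi, ← Complex.ofReal_natCast, Complex.div_ofReal_im,
      Complex.exp_ofReal_mul_I_im]

/-! ### Existence of cutoffs -/

/-- Simultaneous approximation by compactness: the vectors of fractional parts lie in a cube, so a
subsequence is Cauchy, and differences of its indices are the multipliers sought. -/
lemma exists_nat_mul_near_int {n : ℕ} (c : Fin n → ℝ) {δ : ℝ} (hδ : 0 < δ) :
    ∃ H : ℕ → ℕ, Tendsto H atTop atTop ∧ ∀ j k, ∃ ν : ℤ, |H j * c k - ν| < δ := by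
  have hmem : ∀ m : ℕ, (fun k => Int.fract (m * c k)) ∈ Set.Icc (0 : Fin n → ℝ) 1 := fun m =>
    ⟨fun k => Int.fract_nonneg _, fun k => (Int.fract_lt_one _).le⟩
  obtain ⟨l, _, φ, hφ, hl⟩ := isCompact_Icc.tendsto_subseq hmem
  obtain ⟨J, hJ⟩ := Metric.cauchySeq_iff'.1 hl.cauchySeq δ hδ
  refine ⟨fun j => φ (j + J) - φ J, ?_, fun j k =>
    ⟨⌊φ (j + J) * c k⌋ - ⌊φ J * c k⌋, ?_⟩⟩
  · exact (tendsto_sub_atTop_nat (φ J)).comp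
      (hφ.tendsto_atTop.comp (tendsto_add_atTop_nat J))
  · have h1 := hJ (j + J) (Nat.le_add_left J j)
    have h2 := (dist_le_pi_dist _ _ k).trans_lt h1
    rw [Real.dist_eq] at h2
    simp only [Function.comp_apply] at h2
    have h3 : φ J ≤ φ (j + J) := hφ.monotone (Nat.le_add_left J j)
    have h4 : ((φ (j + J) - φ J : ℕ) : ℝ) * c k -
        ((⌊φ (j + J) * c k⌋ - ⌊φ J * c k⌋ : ℤ) : ℝ) =
        Int.fract (φ (j + J) * c k) - Int.fract (φ J * c k) := by
      rw [Nat.cast_sub h3]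
      push_cast
      unfold Int.fract
      ring
    rw [h4]
    exact h2

lemma exists_appropriateCutoffs {n : ℕ} {a : Fin n → ℕ} (ha : ∀ k, (a k).Prime) :
    ∃ R : ℕ → ℝ, AppropriateCutoffs a R := by
  set A : ℝ := 1 + ∑ k, Real.log (a k) with hA
  have hle : ∀ k, Real.log (a k) ≤ A := fun k => by
    have := Finset.single_le_sum (f := fun k => Real.log (a k))
      (fun k _ => (log_natCast_pos (ha k)).le) (Finset.mem_univ k)
    linarith
  have hA0 : 0 < A := by
    have : 0 ≤ ∑ k, Real.log (a k) := Finset.sum_nonneg fun k _ => (log_natCast_pos (ha k)).le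
    linarith
  have hlog2 : 0 < Real.log 2 := Real.log_pos one_lt_two
  -- The shift `t` puts every `t log (a k)` between `2δ` and `1 / 2`, hence at distance at least
  -- `2δ` from all integers; adding `H j` costs less than `δ` of that margin.
  set t : ℝ := 1 / (2 * A) with ht
  have ht0 : 0 < t := by positivity
  set δ : ℝ := t * Real.log 2 / 2 with hδ
  have hδ0 : 0 < δ := by positivity
  obtain ⟨H, hH, hnear⟩ := exists_nat_mul_near_int (fun k => Real.log (a k)) hδ0
  refine ⟨fun j => H j + t, ?_, δ, hδ0, fun j k ν => ?_⟩
  · exact tendsto_atTop_add_const_right _ _ (tendsto_natCast_atTop_atTop.comp hH)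
  · obtain ⟨μ, hμ⟩ := hnear j k
    have h1 : 2 * δ ≤ t * Real.log (a k) := by
      have : Real.log 2 ≤ Real.log (a k) :=
        Real.log_le_log two_pos (by exact_mod_cast (ha k).two_le)
      have := mul_le_mul_of_nonneg_left this ht0.le
      linarith
    have h2 : t * Real.log (a k) ≤ 1 / 2 := by
      have := mul_le_mul_of_nonneg_left (hle k) ht0.le
      have e : t * A = 1 / 2 := by rw [ht]; field_simp
      linarith
    have h3 : 2 * δ ≤ |t * Real.log (a k) - ((ν - μ : ℤ) : ℝ)| := by
      rcases le_or_gt (ν - μ) 0 with h | h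
      · have : ((ν - μ : ℤ) : ℝ) ≤ 0 := by exact_mod_cast h
        exact le_abs.2 (Or.inl (by linarith))
      · have : (1 : ℝ) ≤ ((ν - μ : ℤ) : ℝ) := by exact_mod_cast h
        exact le_abs.2 (Or.inr (by linarith))
    have h4 : (H j + t) * Real.log (a k) - ν =
        (t * Real.log (a k) - ((ν - μ : ℤ) : ℝ)) + (H j * Real.log (a k) - μ) := by
      push_cast; ring
    rw [h4]
    have h5 := abs_sub_abs_le_abs_sub (t * Real.log (a k) - ((ν - μ : ℤ) : ℝ))
      (-(H j * Real.log (a k) - μ))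
    rw [abs_neg, sub_neg_eq_add] at h5
    linarith

/-! ### The counting formula -/

section formula

variable {n : ℕ} {a : Fin n → ℕ} {x : ℝ} {R : ℕ → ℝ}

lemma AppropriateCutoffs.tendsto_rectIntegral (ha : ∀ k, (a k).Prime)
    (hinj : Function.Injective a) (hn : 1 ≤ n) (hx : 1 ≤ x) (hR : AppropriateCutoffs a R) :
    Tendsto (fun j => rectIntegral (perronIntegrand a x) ⟨-1, -(2 * Real.pi * R j)⟩
      ⟨1, 2 * Real.pi * R j⟩) atTop
      (𝓝 (Complex.I *
        ((2 * Real.pi * countProducts a x - Real.pi * productChi a x : ℝ) : ℂ))) := by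
  have hx0 : 0 < x := by linarith
  have hpi := Real.pi_pos
  have hT : Tendsto (fun j => 2 * Real.pi * R j) atTop atTop :=
    hR.1.const_mul_atTop (by positivity)
  have hpos := hR.1.eventually_gt_atTop 0
  have hbot := hR.tendsto_integral_horizontal (fun k => (ha k).ne_zero) hx0
    (τ := fun j => -(2 * Real.pi * R j)) (hpos.mono fun j hj => by
      rw [abs_neg, abs_of_pos (by positivity)])
  have htop := hR.tendsto_integral_horizontal (fun k => (ha k).ne_zero) hx0
    (τ := fun j => 2 * Real.pi * R j) (hpos.mono fun j hj => abs_of_pos (by positivity))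
  have hright := (tendsto_integral_perronIntegrand ha hinj hx0).comp hT
  have hleft := (tendsto_integral_perronIntegrand_left ha hinj hn hx).comp hT
  have h := ((hbot.sub htop).add (hright.const_mul Complex.I)).sub (hleft.const_mul Complex.I)
  rw [sub_zero, zero_add, mul_zero, sub_zero] at h
  refine h.congr fun j => ?_
  simp only [rectIntegral, Function.comp_apply, Complex.ofReal_one, Complex.ofReal_neg]

lemma AppropriateCutoffs.tendsto_fullSum (ha : ∀ k, (a k).Prime) (hinj : Function.Injective a)
    (hn : 1 ≤ n) (hx : 1 ≤ x) (hR : AppropriateCutoffs a R) :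
    Tendsto (fun j => ((1 / (2 ^ (n - 1) * Real.pi) * fullSum a x (R j) : ℝ) : ℂ)) atTop
      (𝓝 (countProducts a x - ((1 / 2 * productChi a x : ℝ) : ℂ) -
        residue (perronIntegrand a x) 0)) := by
  have hx0 : 0 < x := by linarith
  have hpi : (2 * Real.pi * Complex.I : ℂ) ≠ 0 := Complex.two_pi_I_ne_zero
  have h := ((hR.tendsto_rectIntegral ha hinj hn hx).const_mul
    (2 * Real.pi * Complex.I)⁻¹).sub_const (residue (perronIntegrand a x) 0)
  have hlim : (2 * Real.pi * Complex.I)⁻¹ * (Complex.I *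
      ((2 * Real.pi * countProducts a x - Real.pi * productChi a x : ℝ) : ℂ)) =
      countProducts a x - ((1 / 2 * productChi a x : ℝ) : ℂ) := by
    have h1 : (Real.pi : ℂ) ≠ 0 := Complex.ofReal_ne_zero.2 Real.pi_ne_zero
    have h2 := Complex.I_ne_zero
    push_cast
    field_simp
  rw [hlim] at h
  refine h.congr' ?_
  obtain ⟨hlimR, δ, hδ, hcut⟩ := hR
  filter_upwards [hlimR.eventually_gt_atTop 0] with j hj
  rw [rectIntegral_perronIntegrand ha hinj hx0 hj fun k ν h' => ?_,
    inv_mul_cancel_left₀ hpi, add_sub_cancel_left]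
  have := hcut j k ν
  rw [h', sub_self, abs_zero] at this
  linarith

lemma AppropriateCutoffs.tendsto_sum_sin (ha : ∀ k, (a k).Prime) (hR : AppropriateCutoffs a R) :
    Tendsto (fun j => ∑ m : Fin n, ∑ k ∈ Finset.Icc 1 ⌊R j * Real.log (a m)⌋₊,
      Real.sin (2 * Real.pi * k * (Real.log x / Real.log (a m))) / k) atTop
      (𝓝 (∑ m, -(Real.pi * bernoulliStar (Real.log x / Real.log (a m))))) := by
  refine tendsto_finsetSum _ fun m _ => ?_
  exact (tendsto_sum_sin_div _).comp (tendsto_nat_floor_atTop.comp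
    (hR.1.atTop_mul_const (log_natCast_pos (ha m))))

theorem countProducts_eq (ha : ∀ k, (a k).Prime) (hinj : Function.Injective a)
    (hn : 1 ≤ n) (hx : 1 ≤ x) :
    ∃ L : ℝ, (∀ R : ℕ → ℝ, AppropriateCutoffs a R →
        Tendsto (fun j => cotangentSum a x (R j)) atTop (𝓝 L)) ∧
      (countProducts a x : ℂ) = residue (perronIntegrand a x) 0 -
        ((1 / 2 ^ (n - 1) * ∑ k, bernoulliStar (Real.log x / Real.log (a k)) : ℝ) : ℂ) +
        ((1 / (2 ^ (n - 1) * Real.pi) * L : ℝ) : ℂ) + ((1 / 2 * productChi a x : ℝ) : ℂ) := by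
  have hpi := Real.pi_pos
  set c : ℝ := 1 / (2 ^ (n - 1) * Real.pi) with hc
  have hc0 : c ≠ 0 := by positivity
  set Λ : ℂ := countProducts a x - ((1 / 2 * productChi a x : ℝ) : ℂ) -
    residue (perronIntegrand a x) 0 with hΛ
  have hre : ∀ R : ℕ → ℝ, AppropriateCutoffs a R →
      Tendsto (fun j => c * fullSum a x (R j)) atTop (𝓝 Λ.re) := fun R hR => by
    refine ((Complex.continuous_re.tendsto _).comp (hR.tendsto_fullSum ha hinj hn hx)).congr
      fun j => ?_
    rw [Function.comp_apply, Complex.ofReal_re]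
  -- The residue at `0` is not known in advance to be real; `Λ` is real as a limit of real numbers,
  -- for which at least one admissible sequence must exist.
  have hΛre : (Λ.re : ℂ) = Λ := by
    obtain ⟨R, hR⟩ := exists_appropriateCutoffs ha
    exact tendsto_nhds_unique ((Complex.continuous_ofReal.tendsto _).comp (hre R hR))
      (hR.tendsto_fullSum ha hinj hn hx)
  set B : ℝ := ∑ k, bernoulliStar (Real.log x / Real.log (a k)) with hB
  -- The limit of the full sum is `c⁻¹ * Λ.re`, and removing the sawtooth limit `-πB` gives `L`; no
  -- sequence `R` enters.
  refine ⟨c⁻¹ * Λ.re + Real.pi * B, fun R hR => ?_, ?_⟩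
  · have h := ((hre R hR).const_mul c⁻¹).sub (hR.tendsto_sum_sin (x := x) ha)
    have e : c⁻¹ * Λ.re - ∑ m, -(Real.pi * bernoulliStar (Real.log x / Real.log (a m))) =
        c⁻¹ * Λ.re + Real.pi * B := by
      rw [Finset.sum_neg_distrib, ← Finset.mul_sum, sub_neg_eq_add]
    rw [e] at h
    refine h.congr fun j => ?_
    rw [inv_mul_cancel_left₀ hc0, fullSum_eq, add_sub_cancel_left]
  · have e : c * (c⁻¹ * Λ.re + Real.pi * B) = Λ.re + 1 / 2 ^ (n - 1) * B := by
      rw [mul_add, mul_inv_cancel_left₀ hc0, hc]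
      field_simp
    rw [e, Complex.ofReal_add, hΛre, hΛ]
    ring

end formula

lemma prime_firstPrimes (n : ℕ) (k : Fin n) : (firstPrimes n k).Prime := Nat.prime_nth_prime k

lemma firstPrimes_injective (n : ℕ) : Function.Injective (firstPrimes n) := fun _ _ h =>
  Fin.ext (Nat.nth_injective Nat.infinite_setOfPred_prime h)

theorem corollary13 (n : ℕ) (hn : 1 ≤ n) :
    (∃ R : ℕ → ℝ, AppropriateCutoffs (firstPrimes n) R) ∧
    ∀ x : ℝ, 1 ≤ x →
      ∃ L : ℝ,
        (∀ R : ℕ → ℝ, AppropriateCutoffs (firstPrimes n) R →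
          Tendsto (fun j => cotangentSum (firstPrimes n) x (R j)) atTop (𝓝 L)) ∧
        (countProducts (firstPrimes n) x : ℂ) =
          residue (perronIntegrand (firstPrimes n) x) 0
            - ((1 / 2 ^ (n - 1) *
                ∑ k, bernoulliStar (Real.log x / Real.log (firstPrimes n k)) : ℝ) : ℂ)
            + ((1 / (2 ^ (n - 1) * Real.pi) * L : ℝ) : ℂ)
            + ((1 / 2 * productChi (firstPrimes n) x : ℝ) : ℂ) :=
  ⟨exists_appropriateCutoffs (prime_firstPrimes n), fun _ hx =>
    countProducts_eq (prime_firstPrimes n) (firstPrimes_injective n) hn hx⟩
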